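/- Let $\mathbb{B}$ be the Bargmann space of all entire functions $\phi:\mathbb{C}\to\mathbb{C}$ with $\int_{\mathbb{C}}|\phi(z)|^2e^{-|z|^2}\,dx\,dy<\infty$, a Hilbert space for $\langle\phi,\psi\rangle=\frac1\pi\int_{\mathbb{C}}\phi(z)\overline{\psi(z)}e^{-|z|^2}\,dx\,dy$. Let $A\phi=\phi'$ and $A^*\phi=z\phi$ be the annihilation and creation operators. For real $\lambda'',\mu,\lambda$ put $G=A^{*3}A^3$, $H_{\mu,\lambda}=\mu A^*A+i\lambda A^*(A+A^*)A$, and let $H_{\lambda''}=\lambda''G+H_{\mu,\lambda}$, that is, $$H_{\lambda''}\phi(z)=\lambda''z^3\phi'''(z)+i\lambda z\phi''(z)+(i\lambda z^2+\mu z)\phi'(z),$$ act in $\mathbb{B}$ on its maximal domain $D(H_{\lambda''})=\{\phi\in\mathbb{B}: H_{\lambda''}\phi\in\mathbb{B}\}$. For $p>0$, a compact operator $K$ on $\mathbb{B}$ belongs to the Carleman class $\mathcal{C}_p$ if $\sum_n s_n(K)^p<\infty$, where the $s_n(K)$ are the eigenvalues of $\sqrt{K^*K}$ counted with multiplicity.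 **Theorem 8.8.** Let $\lambda''\ge 0$, $\mu>0$ and $\lambda\in\mathbb{R}$. Then $-H_{\lambda''}$ is the infinitesimal generator of a strongly continuous semigroup $(e^{-tH_{\lambda''}})_{t\ge0}$ of bounded operators on $\mathbb{B}$, and $e^{-tH_{\lambda''}}\in\mathcal{C}_p$ for every $p>0$ and every $t>0$. -/

import Mathlib

open MeasureTheory Filter Topology
open scoped ComplexConjugate NNReal ENNReal

/-! ### Carleman classes and strongly continuous semigroups on a complex Hilbert space -/

/-- The Carleman class `C_p` (`p > 0`): the compact operators `K` with `∑ sₙ(K) ^ p < ∞`, where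
`sₙ(K)` runs through the eigenvalues of `√(K* K)`, repeated according to multiplicity.  The sum is
written as a sum over the positive reals `s`, each counted `dim ker (√(K* K) - s)` times. -/
def CarlemanClass {H : Type*} [NormedAddCommGroup H] [InnerProductSpace ℂ H] [CompleteSpace H]
    (p : ℝ) (K : H →L[ℂ] H) : Prop :=
  IsCompactOperator K ∧
    Summable fun s : Set.Ioi (0 : ℝ) =>
      (Module.finrank ℂ
        (Module.End.eigenspace
          ((CFC.sqrt (ContinuousLinearMap.adjoint K * K) : H →L[ℂ] H) : H →ₗ[ℂ] H)
          (((s : ℝ) : ℂ))) : ℝ) * (s : ℝ) ^ p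

/-- A strongly continuous one-parameter semigroup of bounded operators. -/
structure C0Semigroup (H : Type*) [NormedAddCommGroup H] [NormedSpace ℂ H] where
  /-- the operator at time `t ≥ 0` -/
  toFun : ℝ≥0 → H →L[ℂ] H
  map_zero : toFun 0 = 1
  map_add : ∀ s t, toFun (s + t) = toFun s * toFun t
  continuous_orbit : ∀ x, Continuous fun t => toFun t x

/-- The unbounded operator `L` is the infinitesimal generator of the semigroup `T`: a vector `x` is
in the domain of `L` with `L x = y` if and only if `(T t x - x) / t → y` as `t → 0⁺`. -/
def C0Semigroup.IsGenerator {H : Type*} [NormedAddCommGroup H] [NormedSpace ℂ H]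
    (T : C0Semigroup H) (L : H →ₗ.[ℂ] H) : Prop :=
  ∀ x y : H, (x, y) ∈ L.graph ↔
    Tendsto (fun t : ℝ≥0 => ((t : ℝ)⁻¹ : ℂ) • (T.toFun t x - x)) (𝓝[>] 0) (𝓝 y)

namespace Gribov

/-! ### Entire functions, annihilation and creation operators -/

/-- The space of entire functions `ℂ → ℂ`. -/
def Entire : Submodule ℂ (ℂ → ℂ) where
  carrier := {f | Differentiable ℂ f}
  add_mem' hf hg := Differentiable.add hf hg
  zero_mem' := differentiable_const 0
  smul_mem' c _ hf := Differentiable.const_smul hf c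

/-- The annihilation operator acting on entire functions, `A φ = φ'`. -/
noncomputable def annihilation : Module.End ℂ Entire where
  toFun f := ⟨deriv f.1, Differentiable.deriv f.2⟩
  map_add' f g := Subtype.ext <| funext fun z => deriv_add (f.2 z) (g.2 z)
  map_smul' c f := Subtype.ext <| funext fun z => deriv_const_smul c (f.2 z)

/-- The creation operator acting on entire functions, `(A* φ)(z) = z φ(z)`. -/
def creation : Module.End ℂ Entire where
  toFun f := ⟨fun z => z * f.1 z, differentiable_id.mul f.2⟩
  map_add' f g := Subtype.ext <| funext fun z => mul_add z (f.1 z) (g.1 z)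
  map_smul' c f := Subtype.ext <| funext fun z => mul_left_comm z c (f.1 z)

/-- The differential expression `λ'' A*³ A³ + μ A* A + i λ A* (A + A*) A` on entire functions. -/
noncomputable def gribovExpr (lam'' μ lam : ℝ) : Module.End ℂ Entire :=
  (lam'' : ℂ) • (creation ^ 3 * annihilation ^ 3)
    + ((μ : ℂ) • (creation * annihilation)
      + (Complex.I * (lam : ℂ)) • (creation * (annihilation + creation) * annihilation))

/-! ### The Bargmann space -/

/-- The Gaussian measure `π⁻¹ exp (-|z|²) dx dy` on `ℂ`. -/
noncomputable def gaussian : Measure ℂ :=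
  (volume : Measure ℂ).withDensity
    (fun z => ENNReal.ofReal (Real.pi⁻¹ * Real.exp (-‖z‖ ^ 2)))

theorem measurable_density :
    Measurable fun z : ℂ => ENNReal.ofReal (Real.pi⁻¹ * Real.exp (-‖z‖ ^ 2)) := by
  fun_prop

theorem volume_ac_gaussian : (volume : Measure ℂ) ≪ gaussian :=
  withDensity_absolutelyContinuous' measurable_density.aemeasurable
    (Eventually.of_forall fun z => by positivity)

instance : IsProbabilityMeasure gaussian := by
  constructor
  have h := GaussianFourier.integral_rexp_neg_mul_sq_norm (V := ℂ) (b := 1) one_pos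
  have hi : Integrable (fun z : ℂ => Real.exp (-‖z‖ ^ 2)) := by
    by_contra hn
    have h0 := integral_undef hn
    simp [Complex.finrank_real_complex] at h
    rw [h0] at h
    exact Real.pi_ne_zero h.symm
  rw [gaussian, withDensity_apply _ MeasurableSet.univ, Measure.restrict_univ,
    ← ofReal_integral_eq_lintegral_ofReal (hi.const_mul _)
      (Eventually.of_forall fun z => by positivity), integral_const_mul]
  have h' : ∫ z : ℂ, Real.exp (-‖z‖ ^ 2) = Real.pi := by
    simpa [Complex.finrank_real_complex] using h
  rw [h', inv_mul_cancel₀ Real.pi_ne_zero, ENNReal.ofReal_one]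

/-- The entire functions that are square integrable for the Gaussian measure. -/
def squareIntegrable : Submodule ℂ Entire where
  carrier := {f | MemLp f.1 2 gaussian}
  add_mem' hf hg := MemLp.add hf hg
  zero_mem' := MemLp.zero
  smul_mem' c _ hf := MemLp.const_smul hf c

/-- The Bargmann space: the entire functions `φ` with `∫ |φ(z)|² exp (-|z|²) dx dy < ∞`, with the
inner product defined below (and not with the topology of pointwise convergence). -/
def Bargmann : Type := squareIntegrable

namespace Bargmann

section Construction

/-- Pointwise addition.  This is a local instance: outside this section the additive group is
found through the normed structure, which is built on it. -/
@[reducible] def addCommGroup : AddCommGroup Bargmann :=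
  inferInstanceAs (AddCommGroup squareIntegrable)

attribute [local instance] addCommGroup

/-- Pointwise multiplication by scalars; a local instance for the same reason. -/
@[reducible] def module : Module ℂ Bargmann := inferInstanceAs (Module ℂ squareIntegrable)

attribute [local instance] module

/-- An element of the Bargmann space as an entire function. -/
def toEntire : Bargmann →ₗ[ℂ] Entire := squareIntegrable.subtype

instance : CoeFun Bargmann (fun _ => ℂ → ℂ) := ⟨fun φ => (toEntire φ).1⟩

theorem ext_fun {φ ψ : Bargmann} (h : ∀ z, φ z = ψ z) : φ = ψ :=
  Subtype.ext (Subtype.ext (funext h))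

theorem memLp (φ : Bargmann) : MemLp φ 2 gaussian := φ.2

theorem differentiable (φ : Bargmann) : Differentiable ℂ φ := φ.1.2

theorem integrable_inner (φ ψ : Bargmann) :
    Integrable (fun z => conj (φ z) * ψ z) gaussian := by
  have h := (memLp φ).star.integrable_mul (memLp ψ)
  exact h

/-- The inner product `⟪φ, ψ⟫ = π⁻¹ ∫ conj (φ z) ψ z exp (-|z|²) dx dy`. -/
@[reducible] noncomputable def core : InnerProductSpace.Core ℂ Bargmann where
  inner φ ψ := ∫ z, conj (φ z) * ψ z ∂gaussian
  conj_inner_symm φ ψ := by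
    rw [← integral_conj]
    refine integral_congr_ae (Eventually.of_forall fun z => ?_)
    simp [mul_comm]
  re_inner_nonneg φ := by
    have h : (∫ z, conj (φ z) * φ z ∂gaussian) = ((∫ z, ‖φ z‖ ^ 2 ∂gaussian : ℝ) : ℂ) := by
      rw [← integral_complex_ofReal]
      refine integral_congr_ae (Eventually.of_forall fun z => ?_)
      simp [Complex.conj_mul']
    rw [h]
    simpa using integral_nonneg (μ := gaussian) fun z => sq_nonneg ‖φ z‖
  add_left φ ψ χ := by
    rw [← integral_add (integrable_inner φ χ) (integrable_inner ψ χ)]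
    refine integral_congr_ae (Eventually.of_forall fun z => ?_)
    change conj (φ z + ψ z) * χ z = _
    simp [add_mul]
  smul_left φ ψ c := by
    rw [← integral_const_mul]
    refine integral_congr_ae (Eventually.of_forall fun z => ?_)
    change conj (c * φ z) * ψ z = _
    simp [mul_assoc]
  definite φ h := by
    have h1 : (∫ z, conj (φ z) * φ z ∂gaussian) = ((∫ z, ‖φ z‖ ^ 2 ∂gaussian : ℝ) : ℂ) := by
      rw [← integral_complex_ofReal]
      refine integral_congr_ae (Eventually.of_forall fun z => ?_)
      simp [Complex.conj_mul']
    change (∫ z, conj (φ z) * φ z ∂gaussian) = 0 at h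
    rw [h1, Complex.ofReal_eq_zero, integral_eq_zero_iff_of_nonneg (fun z => sq_nonneg ‖φ z‖)
      ((memLp φ).integrable_norm_pow two_ne_zero)] at h
    have h2 : φ =ᵐ[volume] (fun _ => (0 : ℂ)) := by
      filter_upwards [volume_ac_gaussian.ae_eq h] with z hz
      simpa using hz
    have h3 := (differentiable φ).continuous.ae_eq_iff_eq volume continuous_const |>.1 h2
    exact ext_fun fun z => congrFun h3 z

noncomputable instance : NormedAddCommGroup Bargmann :=
  core.toNormedAddCommGroup

noncomputable instance : InnerProductSpace ℂ Bargmann := InnerProductSpace.ofCore core.toCore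

end Construction

theorem inner_eq (φ ψ : Bargmann) : inner ℂ φ ψ = ∫ z, conj (φ z) * ψ z ∂gaussian := rfl

/-- The isometric inclusion into the space `L²(μ)` of classes of functions. -/
noncomputable def toL2 : Bargmann →ₗᵢ[ℂ] Lp ℂ 2 gaussian where
  toFun φ := (memLp φ).toLp φ
  map_add' φ ψ := MemLp.toLp_add (memLp φ) (memLp ψ)
  map_smul' c φ := MemLp.toLp_const_smul c (memLp φ)
  norm_map' φ := by
    have h : inner ℂ ((memLp φ).toLp φ) ((memLp φ).toLp φ) = inner ℂ φ φ := by
      rw [inner_eq, L2.inner_def]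
      refine integral_congr_ae ?_
      filter_upwards [(memLp φ).coeFn_toLp] with z hz
      rw [hz, RCLike.inner_apply, mul_comm]
    change ‖(memLp φ).toLp φ‖ = ‖φ‖
    rw [@norm_eq_sqrt_re_inner ℂ, @norm_eq_sqrt_re_inner ℂ, h]

theorem circle_bound {f : ℂ → ℂ} (hf : Differentiable ℂ f) (w : ℂ) (r : ℝ) :
    ENNReal.ofReal (2 * Real.pi) * ‖f w‖ₑ
      ≤ ∫⁻ θ in Set.Ioo (-Real.pi) Real.pi, ‖f (circleMap w r θ)‖ₑ := by
  have h1 : Real.circleAverage f w r = f w := hf.diffContOnCl.circleAverage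
  rw [Real.circleAverage_eq_integral_add (-Real.pi),
    intervalIntegral.integral_comp_add_right (fun θ => f (circleMap w r θ))] at h1
  have h2 : ∫ θ in (-Real.pi)..Real.pi, f (circleMap w r θ) = (2 * Real.pi : ℝ) • f w := by
    rw [← h1, smul_smul, mul_inv_cancel₀ (by positivity), one_smul]
    congr 1 <;> ring
  have h3 : ENNReal.ofReal (2 * Real.pi) * ‖f w‖ₑ = ‖(2 * Real.pi : ℝ) • f w‖ₑ := by
    rw [enorm_smul, Real.enorm_of_nonneg (by positivity)]
  rw [h3, ← h2, intervalIntegral.integral_of_le (by linarith [Real.pi_pos]),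
    integral_Ioc_eq_integral_Ioo]
  exact enorm_integral_le_lintegral_enorm _

theorem ball_bound {f : ℂ → ℂ} (hf : Differentiable ℂ f) (w : ℂ) :
    ‖f w‖ₑ ≤ ∫⁻ z in Metric.ball w 1, ‖f z‖ₑ := by
  have hc : Continuous f := hf.continuous
  have e1 : ∫⁻ z in Metric.ball w 1, ‖f z‖ₑ
      = ∫⁻ z, (Metric.ball (0 : ℂ) 1).indicator (fun z => ‖f (w + z)‖ₑ) z := by
    rw [← lintegral_indicator Metric.isOpen_ball.measurableSet,
      ← lintegral_add_left_eq_self _ w]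
    refine lintegral_congr fun z => ?_
    have hz : w + z ∈ Metric.ball w 1 ↔ z ∈ Metric.ball (0 : ℂ) 1 := by simp
    by_cases h : z ∈ Metric.ball (0 : ℂ) 1
    · rw [Set.indicator_of_mem h, Set.indicator_of_mem (hz.2 h)]
    · rw [Set.indicator_of_notMem h, Set.indicator_of_notMem fun h' => h (hz.1 h')]
  rw [e1, ← Complex.lintegral_comp_polarCoord_symm]
  have hsub : Set.Ioo (1 / 2 : ℝ) 1 ×ˢ Set.Ioo (-Real.pi) Real.pi ⊆ polarCoord.target := by
    rintro ⟨r, θ⟩ ⟨hr, hθ⟩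
    exact ⟨lt_trans (by norm_num) hr.1, hθ⟩
  refine le_trans ?_ (lintegral_mono_set hsub)
  have e2 : ∫⁻ p in Set.Ioo (1 / 2 : ℝ) 1 ×ˢ Set.Ioo (-Real.pi) Real.pi,
      ENNReal.ofReal (1 / 2) * ‖f (circleMap w p.1 p.2)‖ₑ
      ≤ ∫⁻ p in Set.Ioo (1 / 2 : ℝ) 1 ×ˢ Set.Ioo (-Real.pi) Real.pi,
        ENNReal.ofReal p.1 • (Metric.ball (0 : ℂ) 1).indicator (fun z => ‖f (w + z)‖ₑ)
          (Complex.polarCoord.symm p) := by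
    refine setLIntegral_mono' (measurableSet_Ioo.prod measurableSet_Ioo) ?_
    rintro ⟨r, θ⟩ ⟨hr, hθ⟩
    have hr0 : (0 : ℝ) < r := lt_trans (by norm_num) hr.1
    have hm : Complex.polarCoord.symm (r, θ) ∈ Metric.ball (0 : ℂ) 1 := by
      rw [mem_ball_zero_iff, Complex.norm_polarCoord_symm, abs_of_pos hr0]
      exact hr.2
    have hz : w + Complex.polarCoord.symm (r, θ) = circleMap w r θ := by
      simp [circleMap, Complex.polarCoord_symm_apply, Complex.exp_mul_I]
    rw [Set.indicator_of_mem hm, hz, smul_eq_mul]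
    gcongr
    exact hr.1.le
  refine le_trans ?_ e2
  have hcm : Continuous fun p : ℝ × ℝ => f (circleMap w p.1 p.2) := by
    unfold circleMap
    fun_prop
  rw [Measure.volume_eq_prod, setLIntegral_prod _ (by fun_prop)]
  calc ‖f w‖ₑ ≤ ∫⁻ _ in Set.Ioo (1 / 2 : ℝ) 1,
        ENNReal.ofReal (1 / 2) * (ENNReal.ofReal (2 * Real.pi) * ‖f w‖ₑ) := by
        rw [setLIntegral_const, Real.volume_Ioo, ← mul_assoc, mul_right_comm,
          ← ENNReal.ofReal_mul (by norm_num), ← ENNReal.ofReal_mul (by positivity)]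
        refine le_mul_of_one_le_left' ?_
        rw [ENNReal.one_le_ofReal]
        nlinarith [Real.pi_gt_three]
    _ ≤ _ := by
        refine lintegral_mono fun r => ?_
        dsimp only
        have hr : Measurable fun θ => ‖f (circleMap w r θ)‖ₑ :=
          (hcm.comp (Continuous.prodMk_right r)).enorm.measurable
        rw [lintegral_const_mul _ hr]
        gcongr
        exact circle_bound hf w r

/-- Point evaluations are bounded on the Bargmann space, uniformly on bounded sets. -/
theorem eval_bound (R : ℝ) : ∃ C : ℝ, 0 ≤ C ∧
    ∀ (φ : Bargmann) (w : ℂ), ‖w‖ ≤ R → ‖φ w‖ ≤ C * ‖φ‖ := by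
  refine ⟨Real.pi * Real.exp ((R + 1) ^ 2), by positivity, fun φ w hw => ?_⟩
  set M : ℝ := Real.pi * Real.exp ((R + 1) ^ 2) with hM
  have hM0 : 0 < M := by positivity
  have h1 : ∫⁻ z in Metric.ball w 1, ‖φ z‖ₑ ≤ ENNReal.ofReal M * ∫⁻ z, ‖φ z‖ₑ ∂gaussian := by
    have hφ : Measurable fun z => ‖φ z‖ₑ := (differentiable φ).continuous.enorm.measurable
    rw [gaussian, lintegral_withDensity_eq_lintegral_mul _ measurable_density hφ,
      ← lintegral_const_mul _ (measurable_density.mul hφ)]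
    refine le_trans (setLIntegral_mono' Metric.isOpen_ball.measurableSet fun z hz => ?_)
      (setLIntegral_le_lintegral (Metric.ball w 1) _)
    rw [Pi.mul_apply, ← mul_assoc, ← ENNReal.ofReal_mul hM0.le]
    refine le_mul_of_one_le_left' ?_
    rw [ENNReal.one_le_ofReal, hM]
    have hz1 : ‖z‖ ≤ R + 1 := by
      have := norm_sub_norm_le z w
      rw [mem_ball_iff_norm] at hz
      linarith
    have : Real.pi * Real.exp ((R + 1) ^ 2) * (Real.pi⁻¹ * Real.exp (-‖z‖ ^ 2))
        = Real.exp ((R + 1) ^ 2 - ‖z‖ ^ 2) := by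
      rw [sub_eq_add_neg, Real.exp_add]
      field_simp
    rw [this]
    refine Real.one_le_exp ?_
    nlinarith [norm_nonneg z]
  have h2 : ∫⁻ z, ‖φ z‖ₑ ∂gaussian ≤ ‖φ‖ₑ := by
    rw [← eLpNorm_one_eq_lintegral_enorm, ← toL2.enorm_map φ]
    change _ ≤ ‖(memLp φ).toLp φ‖ₑ
    rw [Lp.enorm_toLp]
    exact eLpNorm_le_eLpNorm_of_exponent_le one_le_two (memLp φ).1
  have h3 : ‖φ w‖ₑ ≤ ENNReal.ofReal M * ‖φ‖ₑ :=
    (ball_bound (differentiable φ) w).trans (h1.trans (by gcongr))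
  rw [← ofReal_norm, ← ofReal_norm, ← ENNReal.ofReal_mul hM0.le] at h3
  exact (ENNReal.ofReal_le_ofReal_iff (by positivity)).1 h3

instance : CompleteSpace Bargmann := by
  refine Metric.complete_of_cauchySeq_tendsto fun u hu => ?_
  have hev : ∀ w, CauchySeq fun n => u n w := by
    intro w
    obtain ⟨C, hC, h⟩ := eval_bound ‖w‖
    rw [Metric.cauchySeq_iff'] at hu ⊢
    intro ε hε
    obtain ⟨N, hN⟩ := hu (ε / (C + 1)) (by positivity)
    refine ⟨N, fun n hn => ?_⟩
    have h1 := h (u n - u N) w le_rfl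
    have h2 := hN n hn
    rw [dist_eq_norm] at h2 ⊢
    rw [lt_div_iff₀ (by positivity)] at h2
    change ‖u n w - u N w‖ ≤ _ at h1
    nlinarith [norm_nonneg (u n - u N)]
  choose φ hφ using fun w => cauchySeq_tendsto_of_complete (hev w)
  have hloc : TendstoLocallyUniformlyOn (fun n => (u n : ℂ → ℂ)) φ atTop Set.univ := by
    rw [tendstoLocallyUniformlyOn_iff_forall_isCompact isOpen_univ]
    intro K _ hK
    obtain ⟨R, hR⟩ := hK.isBounded.exists_norm_le
    obtain ⟨C, hC, h⟩ := eval_bound R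
    refine UniformCauchySeqOn.tendstoUniformlyOn_of_tendsto ?_ fun w _ => hφ w
    rw [Metric.uniformCauchySeqOn_iff]
    intro ε hε
    rw [Metric.cauchySeq_iff] at hu
    obtain ⟨N, hN⟩ := hu (ε / (C + 1)) (by positivity)
    refine ⟨N, fun m hm n hn w hw => ?_⟩
    have h1 := h (u m - u n) w (hR w hw)
    have h2 := hN m hm n hn
    rw [dist_eq_norm] at h2 ⊢
    rw [lt_div_iff₀ (by positivity)] at h2
    change ‖u m w - u n w‖ ≤ _ at h1
    nlinarith [norm_nonneg (u m - u n)]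
  have hd : Differentiable ℂ φ := by
    rw [← differentiableOn_univ]
    exact hloc.differentiableOn
      (Eventually.of_forall fun n => (differentiable (u n)).differentiableOn) isOpen_univ
  obtain ⟨g, hg⟩ := cauchySeq_tendsto_of_complete (toL2.isometry.uniformContinuous.comp_cauchySeq hu)
  have hgφ : g =ᵐ[gaussian] φ := by
    have hm := tendstoInMeasure_of_tendsto_Lp hg
    obtain ⟨ns, hns, hae⟩ := hm.exists_seq_tendsto_ae
    have hall : ∀ᵐ z ∂gaussian, ∀ n, toL2 (u n) z = u n z :=
      ae_all_iff.2 fun n => (memLp (u n)).coeFn_toLp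
    filter_upwards [hae, hall] with z hz hz'
    refine tendsto_nhds_unique hz ?_
    simp only [Function.comp_apply, hz']
    exact (hφ z).comp hns.tendsto_atTop
  have hL : MemLp φ 2 gaussian := (memLp_congr_ae hgφ).1 (Lp.memLp g)
  let ψ : Bargmann := ⟨⟨φ, hd⟩, hL⟩
  refine ⟨ψ, ?_⟩
  have hψ : toL2 ψ = g := Lp.ext ((memLp ψ).coeFn_toLp.trans hgφ.symm)
  rw [toL2.isometry.isEmbedding.tendsto_nhds_iff, hψ]
  exact hg

end Bargmann

/-! ### The unbounded operator -/

/-- The maximal realization in the Bargmann space of an operator `P` on entire functions: its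
domain is the set of all `φ` in the Bargmann space such that `P φ` is in the Bargmann space. -/
noncomputable def maximalRealization (P : Module.End ℂ Entire) : Bargmann →ₗ.[ℂ] Bargmann where
  domain := squareIntegrable.comap (P ∘ₗ Bargmann.toEntire)
  toFun :=
    { toFun := fun φ => (⟨P (Bargmann.toEntire φ.1), φ.2⟩ : squareIntegrable)
      map_add' := fun φ ψ => Subtype.ext (map_add (P ∘ₗ Bargmann.toEntire) φ.1 ψ.1)
      map_smul' := fun c φ => Subtype.ext (map_smul (P ∘ₗ Bargmann.toEntire) c φ.1) }

/-- The Gribov operator `H = λ'' G + H_{μ,λ}` with `G = A*³ A³` and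
`H_{μ,λ} = μ A* A + i λ A* (A + A*) A`, acting in the Bargmann space on its maximal domain. -/
noncomputable def gribovOperator (lam'' μ lam : ℝ) : Bargmann →ₗ.[ℂ] Bargmann :=
  maximalRealization (gribovExpr lam'' μ lam)

end Gribov

/-! In the orthonormal basis `e n = z ^ n / √n!` the operator is a Jacobi matrix: its diagonal is `d
n = lam'' n (n - 1) (n - 2) + μ n ≥ μ n`, and its off-diagonal is `i lam a n` with `a n = n √(n +
1)`. The maximal domain consists of the square summable sequences whose formal image is square
summable (`mem_graph_gribovOperator`). The off-diagonal part is formally skew-adjoint, so the real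
part of the quadratic form is the diagonal, but its growth `n ^ (3 / 2)` is not dominated by `μ n`.

The key is the weight `exp (σ √n)`. Its relative variation between neighbours is of order `σ / √n`,
so in a weighted energy the off-diagonal part contributes only `O(|lam| |σ| n)`, which `μ n` absorbs
for small `σ` (`weight_variation`, `jacobi_energy`). This estimate is used with three kinds of
weight.

With fixed `σ > 0`, the evolutions of the finite compressions, started from finitely supported data,
have rapidly decreasing coordinates uniformly in the truncation. Two truncations differ only through
one edge entry, so Duhamel's formula makes them Cauchy, and contractivity and density give a limit
semigroup.

With `σ` growing linearly in time, the weight costs a further `κ √n ≤ κ n`. Hence `e^{-tH}` maps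
square summable sequences to sequences decaying like `exp (-κ t √n)`, and min-max bounds its `n`-th
singular value by `exp (-κ t √n)`, every power of which is summable.

With `σ < 0`, the boundary terms of an arbitrary square summable sequence are suppressed, so `1 + H`
is injective on the maximal domain (`eq_zero_of_jacobi_eq_neg`). The generator of the limit is
contained in `-H`, and one minus the generator is onto; injectivity then forces equality. -/

namespace Gribov

/-! ### Gaussian integrals of entire functions in polar coordinates. -/

theorem integral_gaussian (g : ℂ → ℂ) :
    ∫ z, g z ∂gaussian = ∫ z, ((Real.pi⁻¹ * Real.exp (-‖z‖ ^ 2) : ℝ) : ℂ) * g z := by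
  rw [gaussian, integral_withDensity_eq_integral_toReal_smul measurable_density
    (Eventually.of_forall fun z => ENNReal.ofReal_lt_top)]
  refine integral_congr_ae (Eventually.of_forall fun z => ?_)
  dsimp only
  rw [ENNReal.toReal_ofReal (by positivity), Complex.real_smul]

theorem integrable_gaussian_iff {g : ℂ → ℂ} :
    Integrable g gaussian ↔
      Integrable fun z : ℂ => ((Real.pi⁻¹ * Real.exp (-‖z‖ ^ 2) : ℝ) : ℂ) * g z := by
  rw [gaussian, integrable_withDensity_iff_integrable_smul' measurable_density
    (Eventually.of_forall fun z => ENNReal.ofReal_lt_top)]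
  refine integrable_congr (Eventually.of_forall fun z => ?_)
  dsimp only
  rw [ENNReal.toReal_ofReal (by positivity), Complex.real_smul]

/-- Cauchy's formula for the derivatives at the origin, in terms of the angle. -/
theorem integral_conj_pow_mul_circle {f : ℂ → ℂ} (hf : Differentiable ℂ f) (n : ℕ) {r : ℝ}
    (hr : 0 < r) :
    ∫ θ in Set.Ioo (-Real.pi) Real.pi, conj (circleMap 0 r θ) ^ n * f (circleMap 0 r θ)
      = 2 * Real.pi * (r ^ (2 * n) * (iteratedDeriv n f 0 / n.factorial)) := by
  lift r to ℝ≥0 using hr.le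
  have hr' : 0 < r := by exact_mod_cast hr
  have h1 := (hf.hasFPowerSeriesOnBall 0 hr').factorial_smul 1 n
  rw [← iteratedDeriv_eq_iteratedFDeriv, cauchyPowerSeries_apply, circleIntegral] at h1
  have hper : Function.Periodic (fun θ => conj (circleMap 0 (r : ℝ) θ) ^ n * f (circleMap 0 r θ))
      (2 * Real.pi) := by
    intro θ
    simp only [periodic_circleMap 0 (r : ℝ) θ]
  have h2 : ∫ θ in Set.Ioo (-Real.pi) Real.pi, conj (circleMap 0 (r : ℝ) θ) ^ n * f (circleMap 0 r θ)
      = ∫ θ in (0)..(2 * Real.pi), conj (circleMap 0 (r : ℝ) θ) ^ n * f (circleMap 0 r θ) := by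
    rw [← integral_Ioc_eq_integral_Ioo, ← intervalIntegral.integral_of_le
      (by linarith [Real.pi_pos])]
    have := hper.intervalIntegral_add_eq (-Real.pi) 0
    rw [zero_add] at this
    rw [← this]
    congr 1
    ring
  have h3 : ∀ θ : ℝ, deriv (circleMap 0 (r : ℝ)) θ • (1 / (circleMap 0 (r : ℝ) θ - 0)) ^ n •
      (circleMap 0 (r : ℝ) θ - 0)⁻¹ • f (circleMap 0 r θ)
      = Complex.I * ((r : ℂ) ^ (2 * n))⁻¹ *
        (conj (circleMap 0 (r : ℝ) θ) ^ n * f (circleMap 0 r θ)) := by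
    intro θ
    have h0 : circleMap 0 (r : ℝ) θ ≠ 0 := by simp [hr.ne']
    -- On the circle `conj z = r ^ 2 / z`, which turns the angular integral into Cauchy's integral
    -- for the `n`-th coefficient.
    have hc : conj (circleMap 0 (r : ℝ) θ) = (r : ℂ) ^ 2 / circleMap 0 (r : ℝ) θ := by
      rw [eq_div_iff h0, Complex.conj_mul', norm_circleMap_zero, abs_of_pos hr]
    have hr0 : (r : ℂ) ≠ 0 := by exact_mod_cast hr'.ne'
    rw [hc]
    simp only [deriv_circleMap, smul_eq_mul, sub_zero, div_pow, one_pow, pow_mul]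
    field_simp
  rw [intervalIntegral.integral_congr (fun θ _ => h3 θ), intervalIntegral.integral_const_mul] at h1
  have hr0 : (r : ℂ) ≠ 0 := by exact_mod_cast hr'.ne'
  have hn : (n.factorial : ℂ) ≠ 0 := by exact_mod_cast n.factorial_ne_zero
  have hpi : (Real.pi : ℂ) ≠ 0 := by exact_mod_cast Real.pi_ne_zero
  rw [h2, ← h1, nsmul_eq_mul, smul_eq_mul]
  field_simp

theorem integrable_polar {g : ℂ → ℂ} (hc : Continuous g) (hg : Integrable g) :
    IntegrableOn (fun p : ℝ × ℝ => p.1 • g (circleMap 0 p.1 p.2))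
      (Set.Ioi 0 ×ˢ Set.Ioo (-Real.pi) Real.pi) := by
  have hcm : Continuous fun p : ℝ × ℝ => circleMap 0 p.1 p.2 := by
    unfold circleMap
    fun_prop
  refine ⟨by fun_prop, ?_⟩
  rw [HasFiniteIntegral]
  refine lt_of_le_of_lt (le_of_eq ?_) hg.2
  rw [← Complex.lintegral_comp_polarCoord_symm]
  refine setLIntegral_congr_fun (measurableSet_Ioi.prod measurableSet_Ioo) ?_
  rintro ⟨r, θ⟩ ⟨hr, hθ⟩
  have hz : circleMap 0 r θ = Complex.polarCoord.symm (r, θ) := by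
    simp [circleMap, Complex.polarCoord_symm_apply, Complex.exp_mul_I]
  simp only [hz, enorm_smul, smul_eq_mul]
  rw [Real.enorm_of_nonneg (le_of_lt hr)]

theorem integral_polar {g : ℂ → ℂ} (hc : Continuous g) (hg : Integrable g) :
    ∫ z, g z = ∫ r in Set.Ioi (0 : ℝ), (r : ℂ) *
      ∫ θ in Set.Ioo (-Real.pi) Real.pi, g (circleMap 0 r θ) := by
  have h := setIntegral_prod _ (integrable_polar hc hg)
  rw [← Measure.volume_eq_prod] at h
  rw [← Complex.integral_comp_polarCoord_symm]
  have h2 : ∫ p in polarCoord.target, p.1 • g (Complex.polarCoord.symm p)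
      = ∫ p in Set.Ioi (0 : ℝ) ×ˢ Set.Ioo (-Real.pi) Real.pi, p.1 • g (circleMap 0 p.1 p.2) := by
    refine setIntegral_congr_fun (measurableSet_Ioi.prod measurableSet_Ioo) ?_
    rintro ⟨r, θ⟩ ⟨hr, hθ⟩
    have hz : circleMap 0 r θ = Complex.polarCoord.symm (r, θ) := by
      simp [circleMap, Complex.polarCoord_symm_apply, Complex.exp_mul_I]
    simp only [hz]
  rw [h2, h]
  refine setIntegral_congr_fun measurableSet_Ioi fun r hr => ?_
  simp only [Complex.real_smul]
  rw [integral_const_mul]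

theorem integral_radial (n : ℕ) :
    ∫ r in Set.Ioi (0 : ℝ), 2 * r ^ (2 * n + 1) * Real.exp (-r ^ 2) = n.factorial := by
  have h := integral_rpow_mul_exp_neg_rpow (p := 2) (q := 2 * n + 1) two_pos
    (by have : (0 : ℝ) ≤ n := n.cast_nonneg; linarith)
  have h1 : ((2 : ℝ) * n + 1 + 1) / 2 = n + 1 := by ring
  rw [h1, Real.Gamma_nat_eq_factorial] at h
  have h2 : ∀ r ∈ Set.Ioi (0 : ℝ), 2 * r ^ (2 * n + 1) * Real.exp (-r ^ 2)
      = 2 * (r ^ ((2 : ℝ) * n + 1) * Real.exp (-r ^ (2 : ℝ))) := by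
    intro r _
    rw [mul_assoc, Real.rpow_two, ← Real.rpow_natCast r (2 * n + 1)]
    push_cast
    rfl
  rw [setIntegral_congr_fun measurableSet_Ioi h2, integral_const_mul, h]
  ring

/-- Each circle isolates the `n`-th Taylor coefficient with factor `r ^ (2 n)`, and the radial
integral supplies the missing `n!`. Working circle by circle avoids interchanging the Taylor series
with the integral. -/
theorem integral_conj_pow_mul {f : ℂ → ℂ} (hf : Differentiable ℂ f) (n : ℕ)
    (hi : Integrable (fun z => conj z ^ n * f z) gaussian) :
    ∫ z, conj z ^ n * f z ∂gaussian = iteratedDeriv n f 0 := by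
  have hc := hf.continuous
  rw [integral_gaussian, integral_polar (by fun_prop) (integrable_gaussian_iff.1 hi)]
  have h1 : ∀ r ∈ Set.Ioi (0 : ℝ), (r : ℂ) * ∫ θ in Set.Ioo (-Real.pi) Real.pi,
      ((Real.pi⁻¹ * Real.exp (-‖circleMap 0 r θ‖ ^ 2) : ℝ) : ℂ)
        * (conj (circleMap 0 r θ) ^ n * f (circleMap 0 r θ))
      = ((2 * r ^ (2 * n + 1) * Real.exp (-r ^ 2) : ℝ) : ℂ)
        * (iteratedDeriv n f 0 / n.factorial) := by
    intro r hr
    have hr' : (0 : ℝ) < r := hr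
    simp only [norm_circleMap_zero, abs_of_pos hr']
    rw [integral_const_mul, integral_conj_pow_mul_circle hf n hr']
    have hpi : (Real.pi : ℂ) ≠ 0 := by exact_mod_cast Real.pi_ne_zero
    push_cast
    field_simp
    ring
  rw [setIntegral_congr_fun measurableSet_Ioi h1, integral_mul_const, integral_complex_ofReal,
    integral_radial]
  have hn : (n.factorial : ℂ) ≠ 0 := by exact_mod_cast n.factorial_ne_zero
  push_cast
  field_simp

theorem memLp_pow (n : ℕ) : MemLp (fun z : ℂ => z ^ n) 2 gaussian := by
  have hI : Integrable fun z : ℂ => Real.exp (-(1 / 2) * ‖z‖ ^ 2) := by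
    -- The integral of a non-integrable function is `0` by convention, whereas the known value of
    -- this one is not.
    by_contra hn
    have h := GaussianFourier.integral_rexp_neg_mul_sq_norm (V := ℂ) (b := 1 / 2) (by norm_num)
    rw [integral_undef hn] at h
    simp [Complex.finrank_real_complex, Real.pi_ne_zero] at h
  rw [memLp_two_iff_integrable_sq_norm (by fun_prop)]
  rw [gaussian, integrable_withDensity_iff_integrable_smul' measurable_density
    (Eventually.of_forall fun z => ENNReal.ofReal_lt_top)]
  refine (hI.const_mul (Real.pi⁻¹ * (2 ^ n * n.factorial))).mono' (by fun_prop)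
    (Eventually.of_forall fun z => ?_)
  rw [ENNReal.toReal_ofReal (by positivity), smul_eq_mul, Real.norm_of_nonneg (by positivity),
    norm_pow]
  -- Half of the Gaussian exponent absorbs `|z| ^ (2 n)`; the other half remains integrable.
  have h := Real.pow_div_factorial_le_exp (‖z‖ ^ 2 / 2) (by positivity) n
  rw [div_le_iff₀ (by positivity), div_pow, div_le_iff₀ (by positivity)] at h
  have he : Real.exp (-(1 / 2) * ‖z‖ ^ 2) = Real.exp (‖z‖ ^ 2 / 2) * Real.exp (-‖z‖ ^ 2) := by
    rw [← Real.exp_add]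
    congr 1
    ring
  rw [he, mul_assoc Real.pi⁻¹, mul_assoc Real.pi⁻¹]
  refine mul_le_mul_of_nonneg_left ?_ (by positivity)
  calc _ = (‖z‖ ^ 2) ^ n * Real.exp (-‖z‖ ^ 2) := by ring
    _ ≤ (Real.exp (‖z‖ ^ 2 / 2) * n.factorial * 2 ^ n) * Real.exp (-‖z‖ ^ 2) := by gcongr
    _ = _ := by ring

/-! ### The Hilbert basis of normalized monomials. -/

namespace Bargmann

/-- The normalized monomial `z ^ n / √n!`. -/
noncomputable def monomial (n : ℕ) : Bargmann :=
  (⟨⟨fun z => ((Real.sqrt n.factorial)⁻¹ : ℝ) * z ^ n, by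
    change Differentiable ℂ fun z : ℂ => (((Real.sqrt n.factorial)⁻¹ : ℝ) : ℂ) * z ^ n
    fun_prop⟩, (memLp_pow n).const_mul _⟩ : squareIntegrable)

theorem monomial_apply (n : ℕ) (z : ℂ) :
    monomial n z = ((Real.sqrt n.factorial)⁻¹ : ℝ) * z ^ n := rfl

theorem inner_monomial (n : ℕ) (φ : Bargmann) :
    inner ℂ (monomial n) φ = ((Real.sqrt n.factorial)⁻¹ : ℝ) * iteratedDeriv n φ 0 := by
  have hi : Integrable (fun z => conj z ^ n * φ z) gaussian := by
    have h := (memLp_pow n).star.integrable_mul φ.memLp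
    refine h.congr (Eventually.of_forall fun z => ?_)
    simp
  rw [inner_eq, ← integral_conj_pow_mul φ.differentiable n hi, ← integral_const_mul]
  refine integral_congr_ae (Eventually.of_forall fun z => ?_)
  simp only [monomial_apply, map_mul, map_pow, Complex.conj_ofReal, mul_assoc]

theorem orthonormal_monomial : Orthonormal ℂ monomial := by
  rw [orthonormal_iff_ite]
  intro i j
  rw [inner_monomial]
  have h1 : iteratedDeriv i (monomial j) 0
      = ((Real.sqrt j.factorial)⁻¹ : ℝ) * iteratedDeriv i (fun z : ℂ => z ^ j) 0 := by
    change iteratedDeriv i (fun z : ℂ => ((Real.sqrt j.factorial)⁻¹ : ℝ) * z ^ j) 0 = _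
    rw [iteratedDeriv_const_mul_field]
  rw [h1]
  rw [iteratedDeriv_pow]
  split_ifs with hij
  · subst hij
    rw [Nat.sub_self, pow_zero, mul_one, Nat.descFactorial_self, ← Complex.ofReal_natCast,
      ← Complex.ofReal_mul, ← Complex.ofReal_mul, ← mul_assoc, ← mul_inv,
      Real.mul_self_sqrt (by positivity), inv_mul_cancel₀ (by positivity), Complex.ofReal_one]
  · rcases lt_or_gt_of_ne hij with h | h
    · rw [zero_pow (Nat.sub_ne_zero_of_lt h)]
      simp
    · rw [Nat.descFactorial_of_lt h]
      simp

theorem ext_iteratedDeriv {f g : ℂ → ℂ} (hf : Differentiable ℂ f) (hg : Differentiable ℂ g)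
    (h : ∀ n, iteratedDeriv n f 0 = iteratedDeriv n g 0) : f = g := by
  funext z
  rw [← Complex.taylorSeries_eq_of_entire' 0 z hf, ← Complex.taylorSeries_eq_of_entire' 0 z hg]
  simp only [h]

/-- The normalized monomials form a Hilbert basis of the Bargmann space. -/
noncomputable def basis : HilbertBasis ℕ ℂ Bargmann :=
  HilbertBasis.mkOfOrthogonalEqBot orthonormal_monomial <| by
    rw [Submodule.eq_bot_iff]
    intro φ hφ
    have h : ∀ n, iteratedDeriv n φ 0 = 0 := by
      intro n
      have h1 := hφ (monomial n) (Submodule.subset_span ⟨n, rfl⟩)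
      rw [inner_monomial, mul_eq_zero] at h1
      refine h1.resolve_left ?_
      rw [Complex.ofReal_eq_zero]
      positivity
    refine ext_fun fun z => congrFun
      (ext_iteratedDeriv φ.differentiable (differentiable_const 0) fun n => ?_) z
    rw [h n]
    simp

theorem basis_apply (n : ℕ) : basis n = monomial n := by
  simp [basis]

end Bargmann

/-! ### The matrix of the operator in this basis. -/

theorem iteratedDeriv_annihilation (f : Entire) (n : ℕ) :
    iteratedDeriv n (annihilation f).1 0 = iteratedDeriv (n + 1) f.1 0 := by
  rw [iteratedDeriv_succ']
  rfl

theorem iteratedDeriv_creation (f : Entire) (n : ℕ) :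
    iteratedDeriv n (creation f).1 0 = n * iteratedDeriv (n - 1) f.1 0 := by
  -- Leibniz' rule at an arbitrary point and for all `f`, so that the induction can pass to `deriv
  -- f`. At `n = 0` the factor `n` hides the truncated index `n - 1`.
  suffices h : ∀ n, ∀ f : ℂ → ℂ, Differentiable ℂ f → ∀ z, iteratedDeriv n (fun z => z * f z) z
      = n * iteratedDeriv (n - 1) f z + z * iteratedDeriv n f z by
    have := h n f.1 f.2 0
    rw [zero_mul, add_zero] at this
    exact this
  intro n
  induction n with
  | zero => simp
  | succ k ih =>
    intro f hf z
    have h1 : deriv (fun z => z * f z) = fun z => f z + z * deriv f z := by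
      funext w
      have := ((hasDerivAt_id w).mul (hf w).hasDerivAt).deriv
      rw [one_mul] at this
      exact this
    have hd := hf.deriv
    have hc : ContDiff ℂ k f := hf.contDiff
    have hc' : ContDiff ℂ k fun z => z * deriv f z := (differentiable_id.mul hd).contDiff
    have h2 := iteratedDeriv_fun_add (x := z) hc.contDiffAt hc'.contDiffAt
    rw [iteratedDeriv_succ', h1, h2, ih _ hd, Nat.add_sub_cancel, iteratedDeriv_succ',
      ]
    rcases k with _ | k
    · simp
    · rw [Nat.add_sub_cancel, ← iteratedDeriv_succ']
      push_cast
      ring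

/-- The diagonal of the matrix of the Gribov operator. -/
noncomputable def diagCoeff (lam'' μ : ℝ) (n : ℕ) : ℝ := lam'' * (n * (n - 1) * (n - 2)) + μ * n

/-- The off-diagonal of the matrix of `A* (A + A*) A`. -/
noncomputable def offCoeff (n : ℕ) : ℝ := n * Real.sqrt (n + 1)

/-- The action on sequences of the matrix with diagonal `d` and off-diagonal `i lam a`. -/
noncomputable def jacobi (d a : ℕ → ℝ) (lam : ℝ) (u : ℕ → ℂ) (n : ℕ) : ℂ :=
  d n * u n + Complex.I * lam * (a n * u (n + 1) + a (n - 1) * u (n - 1))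

theorem iteratedDeriv_gribovExpr (lam'' μ lam : ℝ) (f : Entire) (n : ℕ) :
    iteratedDeriv n (gribovExpr lam'' μ lam f).1 0
      = diagCoeff lam'' μ n * iteratedDeriv n f.1 0 + Complex.I * lam *
        (n * iteratedDeriv (n + 1) f.1 0 + n * (n - 1) * iteratedDeriv (n - 1) f.1 0) := by
  have hadd : ∀ g h : Entire, iteratedDeriv n (g + h).1 0
      = iteratedDeriv n g.1 0 + iteratedDeriv n h.1 0 := fun g h =>
    iteratedDeriv_add (Differentiable.contDiff g.2).contDiffAt
      (Differentiable.contDiff h.2).contDiffAt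
  have hsmul : ∀ (c : ℂ) (g : Entire), iteratedDeriv n (c • g).1 0
      = c * iteratedDeriv n g.1 0 := fun c g =>
    iteratedDeriv_const_smul_field c g.1
  simp only [gribovExpr, LinearMap.add_apply, LinearMap.smul_apply, hadd, hsmul, pow_succ, pow_zero,
    one_mul, Module.End.mul_apply, map_add, iteratedDeriv_creation, iteratedDeriv_annihilation,
    diagCoeff]
  rcases n with _ | _ | _ | n
  · simp
  · simp
  · simp
    ring
  · simp only [Nat.add_sub_cancel]
    push_cast
    ring

theorem inner_monomial_gribov (lam'' μ lam : ℝ) (φ : Bargmann) (n : ℕ) :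
    ((Real.sqrt n.factorial)⁻¹ : ℝ) *
        iteratedDeriv n (gribovExpr lam'' μ lam φ.toEntire).1 0
      = jacobi (diagCoeff lam'' μ) offCoeff lam
          (fun k => inner ℂ (Bargmann.basis k) φ) n := by
  simp only [jacobi, Bargmann.basis_apply, Bargmann.inner_monomial]
  rw [iteratedDeriv_gribovExpr]
  have h1 : ∀ k : ℕ, Real.sqrt (k + 1).factorial = Real.sqrt (k + 1) * Real.sqrt k.factorial := by
    intro k
    rw [Nat.factorial_succ, Nat.cast_mul, Real.sqrt_mul (by positivity)]
    push_cast
    rfl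
  have h2 : ∀ k : ℕ, (Real.sqrt (k + 1) : ℂ) ≠ 0 := by
    intro k
    rw [Complex.ofReal_ne_zero]
    positivity
  have h3 : ∀ k : ℕ, (Real.sqrt k.factorial : ℂ) ≠ 0 := by
    intro k
    rw [Complex.ofReal_ne_zero]
    positivity
  have h4 : ∀ k : ℕ, (Real.sqrt (k + 1) : ℂ) * Real.sqrt (k + 1) = k + 1 := by
    intro k
    rw [← Complex.ofReal_mul, Real.mul_self_sqrt (by positivity)]
    push_cast
    rfl
  rcases n with _ | n
  -- In row `0` the truncated `n - 1` produces an extra term, killed by `offCoeff 0 = 0`.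
  · simp [offCoeff]
  · have h5 := h2 n
    have h6 := h2 (n + 1)
    have h7 := h3 n
    have h8 := h4 n
    simp only [h1, offCoeff, Nat.add_sub_cancel]
    push_cast at h6 ⊢
    field_simp
    linear_combination (-(Complex.I * lam * n * iteratedDeriv n φ 0)) * h8

/-- The graph of the Gribov operator in terms of the coordinates in the basis of monomials. -/
theorem mem_graph_gribovOperator (lam'' μ lam : ℝ) (φ ψ : Bargmann) :
    (φ, ψ) ∈ (gribovOperator lam'' μ lam).graph ↔
      ∀ n, inner ℂ (Bargmann.basis n) ψ = jacobi (diagCoeff lam'' μ) offCoeff lam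
          (fun k => inner ℂ (Bargmann.basis k) φ) n := by
  have h1 : (φ, ψ) ∈ (gribovOperator lam'' μ lam).graph ↔
      gribovExpr lam'' μ lam φ.toEntire = ψ.toEntire := by
    rw [LinearPMap.mem_graph_iff]
    constructor
    · rintro ⟨y, hy, hy'⟩
      dsimp only at hy hy'
      rw [← hy, ← hy']
      rfl
    · intro h
      have hφ : φ ∈ (gribovOperator lam'' μ lam).domain := by
        change gribovExpr lam'' μ lam φ.toEntire ∈ squareIntegrable
        rw [h]
        exact ψ.memLp
      exact ⟨⟨φ, hφ⟩, rfl, Subtype.ext h⟩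
  rw [h1]
  have h2 : ∀ n : ℕ, (((Real.sqrt n.factorial)⁻¹ : ℝ) : ℂ) ≠ 0 := by
    intro k
    rw [Complex.ofReal_ne_zero]
    positivity
  constructor
  · intro h n
    rw [← inner_monomial_gribov, h, Bargmann.basis_apply, Bargmann.inner_monomial]
  · intro h
    -- Taylor coefficients determine an entire function, so equality of coordinates gives equality
    -- of functions, and with it membership in the maximal domain.
    refine Subtype.ext (Bargmann.ext_iteratedDeriv (Subtype.prop _) (Subtype.prop _) fun n => ?_)
    refine mul_left_cancel₀ (h2 n) ?_
    rw [inner_monomial_gribov, ← h n, Bargmann.basis_apply, Bargmann.inner_monomial]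

end Gribov

/-! ### Hilbert bases, min-max and a decay criterion for the Carleman classes. -/

/-- If every set of more than `m` members of a finite family contains a member at most `a m`, then
sums over the family are bounded by sums of the sequence `a`. -/
theorem Finset.sum_le_sum_range_card {J : Type*} [DecidableEq J] (f g : J → ℝ) (a : ℕ → ℝ)
    (h : ∀ S : Finset J, ∀ m, S.card = m + 1 → ∃ j ∈ S, g j ≤ a m) (φ : ℝ → ℝ)
    (hf : ∀ j m, g j ≤ a m → f j ≤ φ (a m)) (S : Finset J) :
    ∑ j ∈ S, f j ≤ ∑ m ∈ Finset.range S.card, φ (a m) := by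
  induction hn : S.card generalizing S with
  | zero => simp [Finset.card_eq_zero.1 hn]
  | succ n ih =>
    obtain ⟨j, hj, hja⟩ := h S n hn
    -- Splitting off one small member at a time replaces arranging the family in decreasing order.
    rw [← Finset.add_sum_erase S f hj, Finset.sum_range_succ, add_comm]
    exact add_le_add (ih (S.erase j) (by rw [Finset.card_erase_of_mem hj, hn]; rfl)) (hf j n hja)

theorem Orthonormal.norm_sq_sum_smul {𝕜 E ι : Type*} [RCLike 𝕜] [NormedAddCommGroup E]
    [InnerProductSpace 𝕜 E] {v : ι → E} (hv : Orthonormal 𝕜 v) (c : ι → 𝕜) (s : Finset ι) :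
    ‖∑ i ∈ s, c i • v i‖ ^ 2 = ∑ i ∈ s, ‖c i‖ ^ 2 := by
  rw [@norm_sq_eq_re_inner 𝕜, hv.inner_sum, map_sum]
  refine Finset.sum_congr rfl fun i _ => ?_
  rw [RCLike.conj_mul]
  norm_cast

namespace HilbertBasis

variable {𝕜 E ι : Type*} [RCLike 𝕜] [NormedAddCommGroup E] [InnerProductSpace 𝕜 E]

theorem hasSum_norm_inner_sq (b : HilbertBasis ι 𝕜 E) (x : E) :
    HasSum (fun i => ‖inner 𝕜 (b i) x‖ ^ 2) (‖x‖ ^ 2) := by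
  have h := RCLike.hasSum_re 𝕜 (b.hasSum_inner_mul_inner x x)
  rw [inner_self_eq_norm_sq] at h
  convert! h using 2 with i
  rw [← inner_conj_symm x, RCLike.conj_mul]
  norm_cast

theorem norm_le_of_sum_range_le (b : HilbertBasis ℕ 𝕜 E) {x : E} {C : ℝ} (hC : 0 ≤ C)
    (h : ∀ M, ∑ n ∈ Finset.range M, ‖inner 𝕜 (b n) x‖ ^ 2 ≤ C ^ 2) : ‖x‖ ≤ C := by
  refine (sq_le_sq₀ (norm_nonneg x) hC).1 ?_
  exact le_of_tendsto' (b.hasSum_norm_inner_sq x).tendsto_sum_nat h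

theorem ext_inner (b : HilbertBasis ι 𝕜 E) {x y : E}
    (h : ∀ i, inner 𝕜 (b i) x = inner 𝕜 (b i) y) : x = y := by
  refine b.repr.injective (lp.ext (funext fun i => ?_))
  rw [b.repr_apply_apply, b.repr_apply_apply, h i]

end HilbertBasis

section Carleman

variable {H : Type*} [NormedAddCommGroup H] [InnerProductSpace ℂ H]

/-- The orthogonal projection on the span of the first `m` vectors of a Hilbert basis. -/
noncomputable def HilbertBasis.truncation (b : HilbertBasis ℕ ℂ H) (m : ℕ) : H →L[ℂ] H :=
  ∑ n ∈ Finset.range m, (innerSL ℂ (b n)).smulRight (b n)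

theorem HilbertBasis.inner_truncation (b : HilbertBasis ℕ ℂ H) (m n : ℕ) (x : H) :
    inner ℂ (b n) (b.truncation m x) = if n < m then inner ℂ (b n) x else 0 := by
  have h := orthonormal_iff_ite.1 b.orthonormal
  simp [HilbertBasis.truncation, h]

/-- In infinite dimension `finrank` is `0` and the empty family serves, so eigenspaces need not be
shown finite-dimensional beforehand. -/
theorem exists_orthonormal_finrank (V : Submodule ℂ H) :
    ∃ v : Fin (Module.finrank ℂ V) → V, Orthonormal ℂ v := by
  by_cases h : FiniteDimensional ℂ V
  · exact ⟨stdOrthonormalBasis ℂ V, (stdOrthonormalBasis ℂ V).orthonormal⟩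
  · rw [Module.finrank_of_not_finite h]
    exact ⟨Fin.elim0, ⟨fun i => i.elim0, fun i => i.elim0⟩⟩

/-- Beyond index `m` the weight is at least `q m`. Compactness uses this with `x` a tail of `y`;
min-max uses it with `x = y`. -/
theorem norm_le_of_weighted_le (b : HilbertBasis ℕ ℂ H) {q : ℕ → ℝ} (hq : Monotone q)
    (hq0 : ∀ n, 0 < q n) {x y : H} {C : ℝ}
    (hC : 0 ≤ C) (m : ℕ)
    (h : ∀ M, ∑ n ∈ Finset.range M, q n ^ 2 * ‖inner ℂ (b n) y‖ ^ 2 ≤ C ^ 2)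
    (hlow : ∀ n < m, inner ℂ (b n) x = 0)
    (hxy : ∀ n, m ≤ n → inner ℂ (b n) x = inner ℂ (b n) y) : ‖x‖ ≤ (q m)⁻¹ * C := by
  have := hq0 m
  refine b.norm_le_of_sum_range_le (by positivity) fun M => ?_
  have h1 : ∀ n, ‖inner ℂ (b n) x‖ ^ 2 ≤ ((q m)⁻¹) ^ 2 * (q n ^ 2 * ‖inner ℂ (b n) y‖ ^ 2) := by
    intro n
    rcases lt_or_ge n m with hn | hn
    · rw [hlow n hn]
      rw [norm_zero, zero_pow two_ne_zero]
      positivity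
    · rw [hxy n hn, ← mul_assoc, ← mul_pow]
      refine le_mul_of_one_le_left (by positivity) (one_le_pow₀ ?_)
      rw [inv_mul_eq_div, one_le_div this]
      exact hq hn
  refine (Finset.sum_le_sum fun n _ => h1 n).trans ?_
  rw [← Finset.mul_sum, mul_pow]
  exact mul_le_mul_of_nonneg_left (h M) (by positivity)


theorem HilbertBasis.isCompactOperator_truncation (b : HilbertBasis ℕ ℂ H) (m : ℕ) :
    IsCompactOperator (b.truncation m) := by
  rw [HilbertBasis.truncation]
  induction m with
  | zero => exact isCompactOperator_zero
  | succ m ih =>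
    rw [Finset.sum_range_succ]
    refine ih.add ?_
    exact (isCompactOperator_of_locallyCompactSpace_rng
      (ContinuousLinearMap.toSpanSingleton ℂ (b m))).comp_clm (innerSL ℂ (b m))

variable [CompleteSpace H]

/-- Both squared norms equal `⟪K* K x, x⟫`; this lets min-max work with `K` itself. -/
theorem norm_sqrt_adjoint_mul_self (K : H →L[ℂ] H) (x : H) :
    ‖CFC.sqrt (ContinuousLinearMap.adjoint K * K) x‖ = ‖K x‖ := by
  set P := CFC.sqrt (ContinuousLinearMap.adjoint K * K) with hP
  have hpos : 0 ≤ ContinuousLinearMap.adjoint K * K := star_mul_self_nonneg K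
  have hsa : IsSelfAdjoint P := (CFC.sqrt_nonneg _).isSelfAdjoint
  have hPP : P * P = ContinuousLinearMap.adjoint K * K := CFC.sqrt_mul_sqrt_self _ hpos
  have h1 : inner ℂ (P x) (P x) = inner ℂ (K x) (K x) := by
    have h2 : inner ℂ (P x) (P x) = inner ℂ ((P * P) x) x := by
      rw [mul_apply_eq_comp, ← ContinuousLinearMap.adjoint_inner_left, hsa.adjoint_eq]
    rw [h2, hPP, mul_apply_eq_comp, ContinuousLinearMap.adjoint_inner_left]
  rw [@norm_eq_sqrt_re_inner ℂ, @norm_eq_sqrt_re_inner ℂ, h1]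

/-- Among `m + 1` orthonormal eigenvectors of `√(K* K)`, one has an eigenvalue at most the norm of
`K` on any subspace cut out by `m` linear functionals. -/
theorem exists_eigenvalue_le {J : Type*} {K : H →L[ℂ] H} {v : J → H} (hv : Orthonormal ℂ v)
    {s : J → ℝ} (hs : ∀ j, 0 ≤ s j)
    (he : ∀ j, CFC.sqrt (ContinuousLinearMap.adjoint K * K) (v j) = (s j : ℂ) • v j)
    {m : ℕ} {a : ℝ} (l : Fin m → H →ₗ[ℂ] ℂ)
    (ha : ∀ x, (∀ i, l i x = 0) → ‖K x‖ ≤ a * ‖x‖)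
    (S : Finset J) (hS : S.card = m + 1) : ∃ j ∈ S, s j ≤ a := by
  by_contra! hlt
  -- There are `m + 1` coefficients and `m` conditions, so some nonzero combination `x` of the
  -- eigenvectors satisfies them all; if every eigenvalue exceeded `a`, then `‖K x‖ > a ‖x‖`.
  let A : (S → ℂ) →ₗ[ℂ] (Fin m → ℂ) :=
    LinearMap.pi fun i => (l i) ∘ₗ (Fintype.linearCombination ℂ fun j : S => v j)
  have hker : LinearMap.ker A ≠ ⊥ := by
    refine LinearMap.ker_ne_bot_of_finrank_lt ?_
    simp [hS]
  obtain ⟨c, hc, hc0⟩ := Submodule.exists_mem_ne_zero_of_ne_bot hker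
  set x : H := ∑ j : S, c j • v j with hx
  have hAx : Fintype.linearCombination ℂ (fun j : S => v j) c = x :=
    Fintype.linearCombination_apply ..
  have hlx : ∀ i, l i x = 0 := by
    intro i
    rw [← hAx]
    exact congrFun (LinearMap.mem_ker.1 hc) i
  have hvS : Orthonormal ℂ fun j : S => v j := hv.comp _ Subtype.val_injective
  have hnx : ‖x‖ ^ 2 = ∑ j : S, ‖c j‖ ^ 2 := hvS.norm_sq_sum_smul c _
  have hPx : ‖K x‖ ^ 2 = ∑ j : S, ‖c j * s j‖ ^ 2 := by
    rw [← norm_sqrt_adjoint_mul_self, hx, map_sum, ← hvS.norm_sq_sum_smul]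
    congr 2
    refine Finset.sum_congr rfl fun j _ => ?_
    rw [map_smul, he, smul_smul]
  obtain ⟨j₀, hj₀⟩ := Function.ne_iff.1 hc0
  -- Comparing squares requires `0 ≤ a`; a negative `a` contradicts the bound directly.
  rcases lt_or_ge a 0 with ha0 | ha0
  · have h1 := ha x hlx
    have h2 : 0 < ‖x‖ ^ 2 := by
      rw [hnx]
      refine Finset.sum_pos' (fun _ _ => by positivity) ⟨j₀, Finset.mem_univ _, ?_⟩
      have := norm_pos_iff.2 hj₀
      positivity
    have h3 : 0 < ‖x‖ := by
      by_contra! h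
      have := le_antisymm h (norm_nonneg x)
      rw [this] at h2
      simp at h2
    nlinarith [norm_nonneg (K x)]
  have h1 : ‖K x‖ ^ 2 ≤ a ^ 2 * ‖x‖ ^ 2 := by
    rw [← mul_pow]
    exact pow_le_pow_left₀ (norm_nonneg _) (ha x hlx) 2
  rw [hnx, hPx, Finset.mul_sum] at h1
  refine absurd h1 (not_le.2 (Finset.sum_lt_sum (fun j _ => ?_) ⟨j₀, Finset.mem_univ _, ?_⟩))
  · rw [norm_mul, mul_pow, Complex.norm_real, Real.norm_of_nonneg (hs j), mul_comm]
    have := hlt j j.2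
    gcongr
  · rw [norm_mul, mul_pow, Complex.norm_real, Real.norm_of_nonneg (hs j₀), mul_comm]
    have := hlt j₀ j₀.2
    have := norm_pos_iff.2 hj₀
    gcongr

variable (b : HilbertBasis ℕ ℂ H) {K : H →L[ℂ] H} {q : ℕ → ℝ}

/-- An operator whose range lies in a space of rapidly decreasing sequences is compact. -/
theorem isCompactOperator_of_decay (hq : Monotone q) (hq0 : ∀ n, 0 < q n)
    (hK : ∀ x M, ∑ n ∈ Finset.range M, q n ^ 2 * ‖inner ℂ (b n) (K x)‖ ^ 2 ≤ ‖x‖ ^ 2)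
    (hlim : Tendsto (fun n => (q n)⁻¹) atTop (𝓝 0)) : IsCompactOperator K := by
  refine isCompactOperator_of_tendsto (F := fun m => (b.truncation m).comp K) (l := atTop) ?_
    (Eventually.of_forall fun m => (b.isCompactOperator_truncation m).comp_clm K)
  rw [tendsto_iff_norm_sub_tendsto_zero]
  refine squeeze_zero (fun _ => norm_nonneg _) (fun m => ?_) hlim
  refine ContinuousLinearMap.opNorm_le_bound _ (inv_nonneg.2 (hq0 m).le) fun x => ?_
  rw [← norm_neg]
  refine norm_le_of_weighted_le b hq hq0 (norm_nonneg x) m (hK x) (fun n hn => ?_) fun n hn => ?_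
  · simp [b.inner_truncation, hn]
  · simp [b.inner_truncation, hn.not_gt]

/-- An operator whose range lies in a space of rapidly decreasing sequences belongs to the
Carleman classes. -/
theorem carlemanClass_of_decay (hq : Monotone q) (hq0 : ∀ n, 0 < q n)
    (hK : ∀ x M, ∑ n ∈ Finset.range M, q n ^ 2 * ‖inner ℂ (b n) (K x)‖ ^ 2 ≤ ‖x‖ ^ 2)
    (hlim : Tendsto (fun n => (q n)⁻¹) atTop (𝓝 0)) {p : ℝ} (hp : 0 < p)
    (hsum : Summable fun n => (q n)⁻¹ ^ p) : CarlemanClass p K := by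
  refine ⟨isCompactOperator_of_decay b hq hq0 hK hlim, ?_⟩
  set P := CFC.sqrt (ContinuousLinearMap.adjoint K * K) with hP
  have hsa : IsSelfAdjoint P := (CFC.sqrt_nonneg _).isSelfAdjoint
  have hsym : (P : H →ₗ[ℂ] H).IsSymmetric := hsa.isSymmetric
  let V : Set.Ioi (0 : ℝ) → Submodule ℂ H := fun s =>
    Module.End.eigenspace (P : H →ₗ[ℂ] H) ((s : ℝ) : ℂ)
  have hV : OrthogonalFamily ℂ (fun s => V s) fun s => (V s).subtypeₗᵢ :=
    hsym.orthogonalFamily_eigenspaces.comp (f := fun s : Set.Ioi (0 : ℝ) => ((s : ℝ) : ℂ))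
      (Complex.ofReal_injective.comp Subtype.val_injective)
  choose v hv using fun s => exists_orthonormal_finrank (V s)
  have hw := hV.orthonormal_sigma_orthonormal hv
  refine summable_of_sum_le (c := ∑' n, (q n)⁻¹ ^ p) (fun s => ?_) fun u => ?_
  · exact mul_nonneg (Nat.cast_nonneg _) (Real.rpow_nonneg s.2.le p)
  classical
  have h1 : ∀ s : Set.Ioi (0 : ℝ), (Module.finrank ℂ (V s) : ℝ) * (s : ℝ) ^ p
      = ∑ _i : Fin (Module.finrank ℂ (V s)), (s : ℝ) ^ p := by
    intro s
    simp
  change ∑ s ∈ u, (Module.finrank ℂ (V s) : ℝ) * (s : ℝ) ^ p ≤ _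
  -- Multiplicities are unfolded: the sum now runs over an orthonormal family of eigenvectors.
  rw [Finset.sum_congr rfl fun s _ => h1 s, ← Finset.sum_sigma u (fun _ => Finset.univ)
    fun x : (Σ s, Fin (Module.finrank ℂ (V s))) => (x.1 : ℝ) ^ p]
  refine (Finset.sum_le_sum_range_card _ (fun x => (x.1 : ℝ)) (fun n => (q n)⁻¹) ?_
    (fun r => r ^ p) ?_ _).trans (hsum.sum_le_tsum _ fun n _ =>
      Real.rpow_nonneg (inv_nonneg.2 (hq0 n).le) p)
  · intro S m hS
    -- The functionals are the first `m` coordinates of `K x`; where they vanish, the decay gives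
    -- `‖K x‖ ≤ (q m)⁻¹ ‖x‖`.
    refine exists_eigenvalue_le (K := K) hw (fun j => j.1.2.le) (fun j => ?_)
      (fun i : Fin m => (((innerSL ℂ (b i)).comp K : H →L[ℂ] ℂ) : H →ₗ[ℂ] ℂ)) (fun x hx => ?_) S hS
    · exact Module.End.mem_eigenspace_iff.1 (v j.1 j.2).2
    · exact norm_le_of_weighted_le b hq hq0 (norm_nonneg x) m (hK x) (fun n hn => hx ⟨n, hn⟩)
        fun n _ => rfl
  · intro j m hj
    exact Real.rpow_le_rpow j.1.2.le hj hp.le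

end Carleman

/-! ### The weight and the energy inequality for Jacobi matrices. -/

namespace Gribov

/-- The weight `exp (σ √n)`. -/
noncomputable def weight (σ : ℝ) (n : ℕ) : ℝ := Real.exp (σ * Real.sqrt n)

theorem weight_pos (σ : ℝ) (n : ℕ) : 0 < weight σ n := Real.exp_pos _

theorem weight_zero (n : ℕ) : weight 0 n = 1 := by simp [weight]

/-- With `x = σ (√(n + 1) - √n)` the difference is `exp x - exp (-x)` times the product of the
weights. The factor `√(n + 1)` is compensated by `√(n + 1) (√(n + 1) - √n) ≤ 1`, and the `4` comes
from `|exp x - 1| ≤ 2 |x|` used twice. -/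
theorem weight_variation {σ : ℝ} (hσ : |σ| ≤ 1) (n : ℕ) :
    Real.sqrt (n + 1) * |weight σ (n + 1) ^ 2 - weight σ n ^ 2|
      ≤ 4 * |σ| * (weight σ n * weight σ (n + 1)) := by
  set r := Real.sqrt n with hr
  set r' := Real.sqrt (n + 1) with hr'
  have hr0 : 0 ≤ r := Real.sqrt_nonneg _
  have hsq : r ^ 2 = n := Real.sq_sqrt n.cast_nonneg
  have hsq' : r' ^ 2 = n + 1 := Real.sq_sqrt (by positivity)
  have hr1 : 1 ≤ r' := Real.one_le_sqrt.2 (by simp)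
  have hle : r ≤ r' := Real.sqrt_le_sqrt (by simp)
  have hd1 : r' * (r' - r) ≤ 1 := by nlinarith
  have hd2 : r' - r ≤ 1 := by nlinarith
  set x := σ * (r' - r) with hx
  have hxa : |x| = |σ| * (r' - r) := by rw [hx, abs_mul, abs_of_nonneg (sub_nonneg.2 hle)]
  have hx1 : |x| ≤ 1 := by
    rw [hxa]
    exact mul_le_one₀ hσ (sub_nonneg.2 hle) hd2
  have hdiff : |Real.exp x - Real.exp (-x)| ≤ 4 * |x| := by
    have h1 := Real.abs_exp_sub_one_le hx1
    have h2 := Real.abs_exp_sub_one_le (x := -x) (by rwa [abs_neg])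
    rw [abs_neg] at h2
    calc |Real.exp x - Real.exp (-x)| = |(Real.exp x - 1) - (Real.exp (-x) - 1)| := by ring_nf
      _ ≤ _ := (abs_sub _ _).trans (by linarith)
  have hw : weight σ (n + 1) ^ 2 - weight σ n ^ 2
      = (Real.exp x - Real.exp (-x)) * (weight σ n * weight σ (n + 1)) := by
    simp only [weight, Nat.cast_add, Nat.cast_one, ← hr, ← hr', sq, ← Real.exp_add, sub_mul]
    congr 2 <;> rw [hx] <;> ring
  have hp : 0 ≤ weight σ n * weight σ (n + 1) :=
    mul_nonneg (weight_pos _ _).le (weight_pos _ _).le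
  rw [hw, abs_mul, abs_of_nonneg hp, ← mul_assoc]
  refine mul_le_mul_of_nonneg_right ?_ hp
  calc r' * |Real.exp x - Real.exp (-x)| ≤ r' * (4 * |x|) := by gcongr
    _ = 4 * |σ| * (r' * (r' - r)) := by rw [hxa]; ring
    _ ≤ 4 * |σ| * 1 := by gcongr
    _ = 4 * |σ| := mul_one _

/-- Summation by parts for the real part of the quadratic form of a Jacobi matrix with imaginary
off-diagonal. -/
theorem re_jacobi_form (d a : ℕ → ℝ) (lam : ℝ) (w : ℕ → ℝ) (u : ℕ → ℂ) (m : ℕ) :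
    ∑ n ∈ Finset.range (m + 1), w n * (conj (u n) * jacobi d a lam u n).re
      = ∑ n ∈ Finset.range (m + 1), d n * (w n * ‖u n‖ ^ 2)
        - lam * a m * w m * (conj (u m) * u (m + 1)).im
        + ∑ n ∈ Finset.range m, lam * a n * (w (n + 1) - w n) * (conj (u n) * u (n + 1)).im := by
  induction m with
  | zero =>
    -- The extra term `i lam a 0 ‖u 0‖ ^ 2`, due to truncated subtraction in row `0`, has zero real
    -- part.
    simp [jacobi, ← Complex.normSq_eq_norm_sq, Complex.normSq_apply]
    ring
  | succ m ih =>
    rw [Finset.sum_range_succ, ih, Finset.sum_range_succ _ (m + 1), Finset.sum_range_succ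
      (fun n => lam * a n * (w (n + 1) - w n) * (conj (u n) * u (n + 1)).im) m]
    simp [jacobi, ← Complex.normSq_eq_norm_sq, Complex.normSq_apply]
    ring

variable {d a : ℕ → ℝ} {μ : ℝ} (lam : ℝ)

/-- Without a weight the off-diagonal terms cancel up to the boundary; with it only the variation of
the weight survives, of order `n`. The sign of `σ` is free and the boundary term is kept, for use
with sequences that are merely bounded. -/
theorem jacobi_energy (ha : ∀ n, |a n| ≤ n * Real.sqrt (n + 1)) {σ : ℝ}
    (hσ : |σ| ≤ 1) (u : ℕ → ℂ) (m : ℕ) :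
    ∑ n ∈ Finset.range (m + 1), (d n - 4 * |lam| * |σ| * n) * (weight σ n ^ 2 * ‖u n‖ ^ 2)
        - |lam| * |a m| * weight σ m ^ 2 * (‖u m‖ * ‖u (m + 1)‖)
      ≤ ∑ n ∈ Finset.range (m + 1), weight σ n ^ 2 * (conj (u n) * jacobi d a lam u n).re := by
  rw [re_jacobi_form d a lam (fun n => weight σ n ^ 2)]
  have him : ∀ n, |(conj (u n) * u (n + 1)).im| ≤ ‖u n‖ * ‖u (n + 1)‖ := by
    intro n
    refine (Complex.abs_im_le_norm _).trans ?_
    rw [norm_mul, RCLike.norm_conj]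
  have h1 : lam * a m * weight σ m ^ 2 * (conj (u m) * u (m + 1)).im
      ≤ |lam| * |a m| * weight σ m ^ 2 * (‖u m‖ * ‖u (m + 1)‖) := by
    refine (le_abs_self _).trans ?_
    rw [abs_mul, abs_mul, abs_mul, abs_of_nonneg (sq_nonneg (weight σ m))]
    gcongr
    exact him m
  have h2 : ∀ n, -(2 * |lam| * |σ| * (n * (weight σ n ^ 2 * ‖u n‖ ^ 2)
        + n * (weight σ (n + 1) ^ 2 * ‖u (n + 1)‖ ^ 2)))
      ≤ lam * a n * (weight σ (n + 1) ^ 2 - weight σ n ^ 2) * (conj (u n) * u (n + 1)).im := by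
    intro n
    refine le_trans (neg_le_neg ?_) (neg_abs_le _)
    rw [abs_mul, abs_mul, abs_mul]
    have hv := weight_variation hσ n
    calc |lam| * |a n| * |weight σ (n + 1) ^ 2 - weight σ n ^ 2| * |(conj (u n) * u (n + 1)).im|
        ≤ |lam| * (n * Real.sqrt (n + 1)) * |weight σ (n + 1) ^ 2 - weight σ n ^ 2|
          * (‖u n‖ * ‖u (n + 1)‖) := by
          gcongr
          · exact ha n
          · exact him n
      _ = |lam| * n * (Real.sqrt (n + 1) * |weight σ (n + 1) ^ 2 - weight σ n ^ 2|)
          * (‖u n‖ * ‖u (n + 1)‖) := by ring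
      _ ≤ |lam| * n * (4 * |σ| * (weight σ n * weight σ (n + 1))) * (‖u n‖ * ‖u (n + 1)‖) := by
          gcongr
      _ = 2 * |lam| * |σ| * n * (2 * (weight σ n * ‖u n‖) * (weight σ (n + 1) * ‖u (n + 1)‖)) := by
          ring
      _ ≤ 2 * |lam| * |σ| * n *
          ((weight σ n * ‖u n‖) ^ 2 + (weight σ (n + 1) * ‖u (n + 1)‖) ^ 2) := by
          gcongr
          exact two_mul_le_add_sq _ _
      _ = _ := by ring
  have h3 := Finset.sum_le_sum fun n (_ : n ∈ Finset.range m) => h2 n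
  rw [Finset.sum_neg_distrib, ← Finset.mul_sum, Finset.sum_add_distrib] at h3
  have h4 : ∑ n ∈ Finset.range m, (n : ℝ) * (weight σ n ^ 2 * ‖u n‖ ^ 2)
      ≤ ∑ n ∈ Finset.range (m + 1), (n : ℝ) * (weight σ n ^ 2 * ‖u n‖ ^ 2) := by
    rw [Finset.sum_range_succ]
    exact le_add_of_nonneg_right (by positivity)
  -- Index shift with `n ≤ n + 1`. Together with `h4`, each coordinate is charged by both its
  -- neighbours, which doubles `2 |lam| |σ| n`.
  have h5 : ∑ n ∈ Finset.range m, (n : ℝ) * (weight σ (n + 1) ^ 2 * ‖u (n + 1)‖ ^ 2)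
      ≤ ∑ n ∈ Finset.range (m + 1), (n : ℝ) * (weight σ n ^ 2 * ‖u n‖ ^ 2) := by
    rw [Finset.sum_range_succ']
    refine le_add_of_le_of_nonneg (Finset.sum_le_sum fun n _ => ?_) (by simp)
    push_cast
    gcongr
    linarith
  have h6 : 0 ≤ 2 * |lam| * |σ| := by positivity
  have h7 := mul_le_mul_of_nonneg_left (add_le_add h4 h5) h6
  simp only [sub_mul, Finset.sum_sub_distrib, mul_assoc, ← Finset.mul_sum] at h7 h3 h1 ⊢
  linarith

end Gribov

/-! ### Finite compressions and their evolutions. -/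

namespace Gribov

variable {E : Type*} [NormedAddCommGroup E] [InnerProductSpace ℂ E]

theorem inner_eq_sum_of_finite {b : HilbertBasis ℕ ℂ E} (x : E) (c : ℕ → ℂ) (s : Finset ℕ) :
    inner ℂ x (∑ n ∈ s, c n • b n) = ∑ n ∈ s, conj (inner ℂ (b n) x) * c n := by
  rw [inner_sum]
  refine Finset.sum_congr rfl fun n _ => ?_
  rw [inner_smul_right, inner_conj_symm, mul_comm]

variable (b : HilbertBasis ℕ ℂ E) (d a : ℕ → ℝ) (lam : ℝ)

/-- The `n`-th coordinate of the image of a vector under a Jacobi matrix. -/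
noncomputable def jacobiRow (n : ℕ) : E →L[ℂ] ℂ :=
  (d n : ℂ) • innerSL ℂ (b n)
    + (Complex.I * lam) • ((a n : ℂ) • innerSL ℂ (b (n + 1)) + (a (n - 1) : ℂ) • innerSL ℂ (b (n - 1)))

theorem jacobiRow_apply (n : ℕ) (x : E) :
    jacobiRow b d a lam n x = jacobi d a lam (fun k => inner ℂ (b k) x) n := by
  simp only [jacobiRow, jacobi, _root_.add_apply, _root_.smul_apply,
    innerSL_apply_apply, smul_eq_mul]

/-- The compression of a Jacobi matrix to the span of the first `m + 1` basis vectors. -/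
noncomputable def galerkin (m : ℕ) : E →L[ℂ] E :=
  (∑ n ∈ Finset.range (m + 1), (jacobiRow b d a lam n).smulRight (b n)).comp (b.truncation (m + 1))

theorem galerkin_apply (m : ℕ) (x : E) :
    galerkin b d a lam m x = ∑ n ∈ Finset.range (m + 1),
      jacobi d a lam (fun k => if k < m + 1 then inner ℂ (b k) x else 0) n • b n := by
  have h : (fun k => if k < m + 1 then inner ℂ (b k) x else 0)
      = fun k => inner ℂ (b k) (b.truncation (m + 1) x) := by
    funext k
    rw [b.inner_truncation]
  rw [h]
  simp [galerkin, jacobiRow_apply]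

theorem inner_galerkin (m n : ℕ) (x : E) :
    inner ℂ (b n) (galerkin b d a lam m x) = if n < m + 1 then
      jacobi d a lam (fun k => if k < m + 1 then inner ℂ (b k) x else 0) n else 0 := by
  have h := orthonormal_iff_ite.1 b.orthonormal
  simp [galerkin_apply, h]

variable {d a}

/-- The truncated vector has zero coordinate `m + 1`, so the boundary term disappears. -/
theorem galerkin_energy (ha : ∀ n, |a n| ≤ n * Real.sqrt (n + 1)) {σ : ℝ}
    (hσ : |σ| ≤ 1) (x : E) (m : ℕ) :
    ∑ n ∈ Finset.range (m + 1),
        (d n - 4 * |lam| * |σ| * n) * (weight σ n ^ 2 * ‖inner ℂ (b n) x‖ ^ 2)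
      ≤ ∑ n ∈ Finset.range (m + 1), weight σ n ^ 2 *
        (conj (inner ℂ (b n) x) * inner ℂ (b n) (galerkin b d a lam m x)).re := by
  have h := jacobi_energy (d := d) lam ha hσ (fun k => if k < m + 1 then inner ℂ (b k) x else 0) m
  rw [if_neg (lt_irrefl (m + 1)), norm_zero, mul_zero, mul_zero, sub_zero] at h
  refine le_trans (le_of_eq ?_) (h.trans (le_of_eq ?_)) <;>
  · refine Finset.sum_congr rfl fun n hn => ?_
    simp only [inner_galerkin, if_pos (Finset.mem_range.1 hn)]

theorem re_inner_galerkin_nonneg (hd : ∀ n, 0 ≤ d n) (ha : ∀ n, |a n| ≤ n * Real.sqrt (n + 1))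
    (m : ℕ) (x : E) : 0 ≤ (inner ℂ x (galerkin b d a lam m x)).re := by
  have h := galerkin_energy b (d := d) lam ha (σ := 0) (by simp) x m
  simp only [weight_zero, abs_zero, mul_zero, zero_mul, sub_zero, one_pow, one_mul] at h
  have h0 : inner ℂ x (galerkin b d a lam m x) = ∑ n ∈ Finset.range (m + 1),
      conj (inner ℂ (b n) x) * inner ℂ (b n) (galerkin b d a lam m x) := by
    conv_lhs => rw [galerkin_apply, inner_eq_sum_of_finite]
    refine Finset.sum_congr rfl fun n hn => ?_
    rw [inner_galerkin, if_pos (Finset.mem_range.1 hn)]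
  rw [h0, Complex.re_sum]
  exact le_trans (Finset.sum_nonneg fun n _ => mul_nonneg (hd n) (sq_nonneg _)) h

variable [CompleteSpace E] (d a)

/-- The evolution generated by the compressed matrix. -/
noncomputable def galerkinEvolution (m : ℕ) (t : ℝ) : E →L[ℂ] E :=
  NormedSpace.exp ((t : ℂ) • -galerkin b d a lam m)

theorem galerkinEvolution_zero (m : ℕ) : galerkinEvolution b d a lam m 0 = 1 := by
  simp [galerkinEvolution]

theorem galerkinEvolution_add (m : ℕ) (s t : ℝ) :
    galerkinEvolution b d a lam m (s + t)
      = galerkinEvolution b d a lam m s * galerkinEvolution b d a lam m t := by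
  let _ : NormedAlgebra ℚ (E →L[ℂ] E) := NormedAlgebra.restrictScalars ℚ ℂ _
  rw [galerkinEvolution, galerkinEvolution, galerkinEvolution, ← NormedSpace.exp_add_of_commute,
    Complex.ofReal_add, add_smul]
  exact ((Commute.refl _).smul_left _).smul_right _

theorem hasDerivAt_galerkinEvolution (m : ℕ) (x : E) (t : ℝ) :
    HasDerivAt (fun t => galerkinEvolution b d a lam m t x)
      (-galerkin b d a lam m (galerkinEvolution b d a lam m t x)) t := by
  have h := (hasDerivAt_exp_smul_const' (𝕂 := ℂ) (-galerkin b d a lam m) (t : ℂ)).clm_apply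
    (hasDerivAt_const (t : ℂ) x)
  refine (h.scomp t Complex.ofRealCLM.hasDerivAt).congr_deriv ?_
  simp [galerkinEvolution]

variable {d a}

/-- The derivative of the squared norm is `-2 Re ⟪u, G u⟫`, nonpositive by the energy inequality at
`σ = 0`. -/
theorem norm_galerkinEvolution_le (hd : ∀ n, 0 ≤ d n) (ha : ∀ n, |a n| ≤ n * Real.sqrt (n + 1))
    (m : ℕ) {t : ℝ} (ht : 0 ≤ t) (x : E) : ‖galerkinEvolution b d a lam m t x‖ ≤ ‖x‖ := by
  have h1 : ∀ t, HasDerivAt (fun t => (inner ℂ (galerkinEvolution b d a lam m t x)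
      (galerkinEvolution b d a lam m t x)).re) (-2 * (inner ℂ (galerkinEvolution b d a lam m t x)
        (galerkin b d a lam m (galerkinEvolution b d a lam m t x))).re) t := by
    intro t
    have hu := hasDerivAt_galerkinEvolution b d a lam m x t
    have h := (hu.inner ℂ hu)
    have h2 := Complex.reCLM.hasFDerivAt.comp_hasDerivAt t h
    refine h2.congr_deriv ?_
    rw [Complex.reCLM_apply, Complex.add_re, inner_neg_right, inner_neg_left,
      ← inner_conj_symm (galerkin b d a lam m _), Complex.neg_re, Complex.neg_re, Complex.conj_re]
    ring
  have h2 := antitone_of_hasDerivAt_nonpos h1 (fun t => by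
    have := re_inner_galerkin_nonneg b lam hd ha m (galerkinEvolution b d a lam m t x)
    simp only [Pi.zero_apply]
    linarith) ht
  simp only [galerkinEvolution_zero] at h2
  have h3 : ∀ y : E, (inner ℂ y y).re = ‖y‖ ^ 2 := fun y => inner_self_eq_norm_sq (𝕜 := ℂ) y
  rw [h3, h3] at h2
  exact (sq_le_sq₀ (norm_nonneg _) (norm_nonneg _)).1 h2

/-- Propagation and creation of decay of the coordinates, uniformly in the truncation. -/
theorem galerkinEvolution_weighted_le {μ : ℝ} (hd : ∀ n : ℕ, μ * n ≤ d n)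
    (ha : ∀ n, |a n| ≤ n * Real.sqrt (n + 1)) (m : ℕ) {σ κ t : ℝ} (ht : 0 ≤ t) (hκ : 0 ≤ κ)
    (hσ : 0 ≤ σ) (h1 : σ + κ * t ≤ 1) (hμ : κ + 4 * |lam| * (σ + κ * t) ≤ μ) (x : E) :
    ∑ n ∈ Finset.range (m + 1), weight (σ + κ * t) n ^ 2 *
        ‖inner ℂ (b n) (galerkinEvolution b d a lam m t x)‖ ^ 2
      ≤ ∑ n ∈ Finset.range (m + 1), weight σ n ^ 2 * ‖inner ℂ (b n) x‖ ^ 2 := by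
  set u : ℝ → E := fun s => galerkinEvolution b d a lam m s x with hu
  have hw : ∀ s n, HasDerivAt (fun s => weight (σ + κ * s) n ^ 2)
      (2 * κ * Real.sqrt n * weight (σ + κ * s) n ^ 2) s := by
    intro s n
    have h := ((((hasDerivAt_id s).const_mul κ).const_add σ).mul_const (Real.sqrt n)).exp.pow 2
    refine h.congr_deriv ?_
    simp only [weight, id]
    push_cast
    ring
  have hc : ∀ s n, HasDerivAt (fun s => ‖inner ℂ (b n) (u s)‖ ^ 2)
      (-2 * (conj (inner ℂ (b n) (u s)) * inner ℂ (b n) (galerkin b d a lam m (u s))).re) s := by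
    intro s n
    have h := ((innerSL ℂ (b n)).restrictScalars ℝ).hasFDerivAt.comp_hasDerivAt s
      (hasDerivAt_galerkinEvolution b d a lam m x s)
    have h2 := h.norm_sq
    refine h2.congr_deriv ?_
    simp [Complex.inner, hu]
    ring
  have hder : ∀ s, HasDerivAt (fun s => ∑ n ∈ Finset.range (m + 1),
      weight (σ + κ * s) n ^ 2 * ‖inner ℂ (b n) (u s)‖ ^ 2)
      (∑ n ∈ Finset.range (m + 1), (2 * κ * Real.sqrt n * weight (σ + κ * s) n ^ 2 *
        ‖inner ℂ (b n) (u s)‖ ^ 2 + weight (σ + κ * s) n ^ 2 * (-2 * (conj (inner ℂ (b n) (u s)) *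
          inner ℂ (b n) (galerkin b d a lam m (u s))).re))) s :=
    fun s => HasDerivAt.fun_sum fun n _ => (hw s n).mul (hc s n)
  have hanti : AntitoneOn (fun s => ∑ n ∈ Finset.range (m + 1),
      weight (σ + κ * s) n ^ 2 * ‖inner ℂ (b n) (u s)‖ ^ 2) (Set.Icc 0 t) := by
    refine antitoneOn_of_deriv_nonpos (convex_Icc 0 t)
      (fun s _ => (hder s).continuousAt.continuousWithinAt)
      (fun s _ => (hder s).differentiableAt.differentiableWithinAt) fun s hs => ?_
    rw [interior_Icc] at hs
    rw [(hder s).deriv]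
    have hs0 : 0 ≤ σ + κ * s := add_nonneg hσ (mul_nonneg hκ hs.1.le)
    have hst : σ + κ * s ≤ σ + κ * t := by
      have := mul_le_mul_of_nonneg_left hs.2.le hκ
      linarith
    have hen := galerkin_energy b (d := d) lam ha (σ := σ + κ * s)
      (by rw [abs_of_nonneg hs0]; linarith) (u s) m
    rw [abs_of_nonneg hs0] at hen
    -- The growing weight costs `κ √n ≤ κ n` and the coupling `4 |lam| (σ + κ s) n`; by `hμ` they
    -- total at most `μ n ≤ d n`.
    have hdamp : ∑ n ∈ Finset.range (m + 1), κ * Real.sqrt n *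
          (weight (σ + κ * s) n ^ 2 * ‖inner ℂ (b n) (u s)‖ ^ 2)
        ≤ ∑ n ∈ Finset.range (m + 1), (d n - 4 * |lam| * (σ + κ * s) * n) *
          (weight (σ + κ * s) n ^ 2 * ‖inner ℂ (b n) (u s)‖ ^ 2) := by
      refine Finset.sum_le_sum fun n _ => mul_le_mul_of_nonneg_right ?_ (by positivity)
      have hn : Real.sqrt n ≤ n := by
        rcases n with _ | n
        · simp
        · rw [Real.sqrt_le_left (by positivity)]
          push_cast
          nlinarith [(n.cast_nonneg : (0 : ℝ) ≤ n)]
      have h2 : κ * Real.sqrt n ≤ κ * n := mul_le_mul_of_nonneg_left hn hκ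
      have h3 : 4 * |lam| * (σ + κ * s) ≤ 4 * |lam| * (σ + κ * t) := by gcongr
      have h4 : (κ + 4 * |lam| * (σ + κ * s)) * n ≤ μ * n :=
        mul_le_mul_of_nonneg_right (by linarith) n.cast_nonneg
      have := hd n
      nlinarith
    have hfin := hdamp.trans hen
    have heq : ∑ n ∈ Finset.range (m + 1), (2 * κ * Real.sqrt n * weight (σ + κ * s) n ^ 2 *
        ‖inner ℂ (b n) (u s)‖ ^ 2 + weight (σ + κ * s) n ^ 2 * (-2 * (conj (inner ℂ (b n) (u s)) *
          inner ℂ (b n) (galerkin b d a lam m (u s))).re))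
      = 2 * (∑ n ∈ Finset.range (m + 1), κ * Real.sqrt n *
          (weight (σ + κ * s) n ^ 2 * ‖inner ℂ (b n) (u s)‖ ^ 2)) - 2 * ∑ n ∈ Finset.range (m + 1),
          weight (σ + κ * s) n ^ 2 * (conj (inner ℂ (b n) (u s)) *
            inner ℂ (b n) (galerkin b d a lam m (u s))).re := by
      rw [Finset.mul_sum, Finset.mul_sum, ← Finset.sum_sub_distrib]
      refine Finset.sum_congr rfl fun n _ => ?_
      ring
    rw [heq]
    linarith
  have h := hanti (Set.left_mem_Icc.2 ht) (Set.right_mem_Icc.2 ht) ht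
  simpa [hu, galerkinEvolution_zero] using h

end Gribov

/-! ### General facts on contraction semigroups. -/

section Semigroup

variable {E : Type*} [NormedAddCommGroup E] [NormedSpace ℂ E]

theorem tendsto_nnreal_smul_sub_of_hasDerivWithinAt {f : ℝ → E} {y : E}
    (hf : HasDerivWithinAt f y (Set.Ioi 0) 0) :
    Tendsto (fun t : ℝ≥0 => ((t : ℝ)⁻¹ : ℂ) • (f t - f 0)) (𝓝[>] 0) (𝓝 y) := by
  rw [hasDerivWithinAt_iff_tendsto_slope' (by simp)] at hf
  have h1 : Tendsto (fun t : ℝ≥0 => (t : ℝ)) (𝓝[>] 0) (𝓝[>] 0) := by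
    refine tendsto_nhdsWithin_iff.2 ⟨?_, ?_⟩
    · exact (NNReal.continuous_coe.tendsto 0).mono_left nhdsWithin_le_nhds
    · filter_upwards [self_mem_nhdsWithin] with t ht
      exact NNReal.coe_pos.2 ht
  refine (hf.comp h1).congr fun t => ?_
  rw [Function.comp_apply, slope_def_module, sub_zero, ← Complex.ofReal_inv, Complex.coe_smul]

variable [CompleteSpace E]

/-- The range of `1 - L`, for `L` the generator of a contraction semigroup, is the whole space. -/
theorem C0Semigroup.exists_resolvent (T : C0Semigroup E) (hT : ∀ t x, ‖T.toFun t x‖ ≤ ‖x‖)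
    (g : E) : ∃ z, Tendsto (fun t : ℝ≥0 => ((t : ℝ)⁻¹ : ℂ) • (T.toFun t z - z)) (𝓝[>] 0)
      (𝓝 (z - g)) := by
  -- The resolvent at `1` is the Laplace transform of the orbit; applying `T h` shifts the integral,
  -- whose dependence on `h` is then differentiated.
  let F : ℝ → E := fun s => Real.exp (-s) • T.toFun s.toNNReal g
  have hFc : Continuous F :=
    (Real.continuous_exp.comp continuous_neg).smul
      ((T.continuous_orbit g).comp continuous_real_toNNReal)
  have hFi : IntegrableOn F (Set.Ioi 0) := by
    refine ((integrableOn_exp_neg_Ioi 0).mul_const ‖g‖).mono' hFc.aestronglyMeasurable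
      (Eventually.of_forall fun s => ?_)
    rw [norm_smul, Real.norm_of_nonneg (Real.exp_pos _).le]
    gcongr
    exact hT _ _
  set z : E := ∫ s in Set.Ioi (0 : ℝ), F s with hz
  have hTz : ∀ h : ℝ≥0, T.toFun h z = Real.exp h • (z - ∫ s in (0 : ℝ)..h, F s) := by
    intro h
    have h1 : ∫ s in Set.Ioi (h : ℝ), F s = z - ∫ s in (0 : ℝ)..h, F s := by
      rw [eq_sub_iff_add_eq, add_comm, hz]
      exact intervalIntegral.integral_interval_add_Ioi hFi
        (hFi.mono_set (Set.Ioi_subset_Ioi h.coe_nonneg))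
    rw [← h1, hz, ← ContinuousLinearMap.integral_comp_comm _ hFi]
    have h2 := (measurePreserving_add_right volume (h : ℝ)).setIntegral_preimage_emb
      (measurableEmbedding_addRight (h : ℝ)) F (Set.Ioi (h : ℝ))
    rw [Set.preimage_add_const_Ioi, sub_self] at h2
    rw [← h2, ← integral_smul]
    refine setIntegral_congr_fun measurableSet_Ioi fun s hs => ?_
    have hs0 : (0 : ℝ) ≤ s := le_of_lt hs
    simp only [F]
    rw [smul_smul, ← Real.exp_add, Real.toNNReal_add hs0 h.coe_nonneg, Real.toNNReal_coe, add_comm _ h,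
      T.map_add, mul_apply_eq_comp]
    rw [ContinuousLinearMap.map_smul_of_tower]
    congr 2
    ring
  refine ⟨z, ?_⟩
  have hd : HasDerivAt (fun h : ℝ => Real.exp h • (z - ∫ s in (0 : ℝ)..h, F s)) (z - g) 0 := by
    have h1 : HasDerivAt (fun h : ℝ => ∫ s in (0 : ℝ)..h, F s) (F 0) 0 :=
      intervalIntegral.integral_hasDerivAt_right (by simp)
        (hFc.stronglyMeasurableAtFilter _ _) hFc.continuousAt
    have h2 := (Real.hasDerivAt_exp 0).smul (h1.const_sub z)
    refine h2.congr_deriv ?_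
    simp [F, T.map_zero]
    abel
  have h := tendsto_nnreal_smul_sub_of_hasDerivWithinAt hd.hasDerivWithinAt
  refine h.congr fun t => ?_
  rw [hTz]
  simp

/-- Comparison of two exponentials by Duhamel's formula. -/
theorem norm_exp_smul_sub_le {A B : E →L[ℂ] E} {x : E} {t ε : ℝ} (ht : 0 ≤ t)
    (hB : ∀ s : ℝ, 0 ≤ s → ∀ y, ‖NormedSpace.exp ((s : ℂ) • B) y‖ ≤ ‖y‖)
    (hε : ∀ s : ℝ, 0 ≤ s → ‖(A - B) (NormedSpace.exp ((s : ℂ) • A) x)‖ ≤ ε) :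
    ‖NormedSpace.exp ((t : ℂ) • A) x - NormedSpace.exp ((t : ℂ) • B) x‖ ≤ ε * t := by
  -- This path joins the two exponentials, and its derivative is `exp ((t - s) B) (A - B) exp (s A)
  -- x`.
  let f : ℝ → E := fun s =>
    NormedSpace.exp (((t : ℂ) - s) • B) (NormedSpace.exp ((s : ℂ) • A) x)
  have hf : ∀ s : ℝ, HasDerivAt f (NormedSpace.exp (((t : ℂ) - s) • B)
      ((A - B) (NormedSpace.exp ((s : ℂ) • A) x))) s := by
    intro s
    have h1 : HasDerivAt (fun z : ℂ => NormedSpace.exp (((t : ℂ) - z) • B))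
        (-(NormedSpace.exp (((t : ℂ) - s) • B) * B)) (s : ℂ) := by
      have h := (hasDerivAt_exp_smul_const (𝕂 := ℂ) B ((t : ℂ) - s)).scomp (s : ℂ)
        ((hasDerivAt_id (s : ℂ)).const_sub (t : ℂ))
      exact h.congr_deriv (by simp)
    have h2 : HasDerivAt (fun z : ℂ => NormedSpace.exp (z • A) x)
        (A (NormedSpace.exp ((s : ℂ) • A) x)) (s : ℂ) := by
      simpa using (hasDerivAt_exp_smul_const' (𝕂 := ℂ) A (s : ℂ)).clm_apply
        (hasDerivAt_const (s : ℂ) x)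
    have h3 := (h1.clm_apply h2).scomp s Complex.ofRealCLM.hasDerivAt
    refine h3.congr_deriv ?_
    simp
    abel
  have h := norm_image_sub_le_of_norm_deriv_le_segment' (f := f) (a := 0) (b := t) (C := ε)
    (fun s _ => (hf s).hasDerivWithinAt) (fun s hs => ?_) t (Set.right_mem_Icc.2 ht)
  · simpa [f] using h
  · have h1 := hB (t - s) (by linarith [hs.2]) ((A - B) (NormedSpace.exp ((s : ℂ) • A) x))
    push_cast at h1
    exact h1.trans (hε s hs.1)

/-- A sequence of contraction semigroups whose orbits are uniformly Cauchy on bounded intervals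
converges to a contraction semigroup. -/
theorem exists_limit_semigroup (S : ℕ → ℝ≥0 → E →L[ℂ] E) (h0 : ∀ m, S m 0 = 1)
    (hadd : ∀ m s t, S m (s + t) = S m s * S m t) (hcont : ∀ m x, Continuous fun t => S m t x)
    (hcontr : ∀ m t x, ‖S m t x‖ ≤ ‖x‖)
    (hcauchy : ∀ x R, UniformCauchySeqOn (fun m t => S m t x) atTop (Set.Iic R)) :
    ∃ T : C0Semigroup E, (∀ t x, ‖T.toFun t x‖ ≤ ‖x‖) ∧
      ∀ x R, TendstoUniformlyOn (fun m t => S m t x) (fun t => T.toFun t x) atTop (Set.Iic R) := by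
  have hex : ∀ t x, ∃ y, Tendsto (fun m => S m t x) atTop (𝓝 y) := fun t x =>
    cauchySeq_tendsto_of_complete ((hcauchy x t).cauchySeq (Set.mem_Iic.2 le_rfl))
  choose F hF using hex
  have hFle : ∀ t x, ‖F t x‖ ≤ ‖x‖ := fun t x =>
    le_of_tendsto' (hF t x).norm fun m => hcontr m t x
  let T : ℝ≥0 → E →L[ℂ] E := fun t => LinearMap.mkContinuous
    { toFun := F t
      map_add' := fun x y => tendsto_nhds_unique (hF t (x + y)) (by
        simpa only [map_add] using (hF t x).add (hF t y))
      map_smul' := fun c x => tendsto_nhds_unique (hF t (c • x)) (by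
        simpa only [map_smul, RingHom.id_apply] using (hF t x).const_smul c) } 1
    fun x => by rw [one_mul]; exact hFle t x
  have hT : ∀ t x, T t x = F t x := fun _ _ => rfl
  have hunif : ∀ x R, TendstoUniformlyOn (fun m t => S m t x) (fun t => T t x) atTop (Set.Iic R) :=
    fun x R => (hcauchy x R).tendstoUniformlyOn_of_tendsto fun t _ => hF t x
  refine ⟨⟨T, ?_, fun s t => ?_, fun x => ?_⟩, hFle, hunif⟩
  · ext x
    refine tendsto_nhds_unique (hF 0 x) ?_
    simp only [h0]
    exact tendsto_const_nhds
  · ext x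
    refine tendsto_nhds_unique (hF (s + t) x) ?_
    rw [mul_apply_eq_comp, hT, hT]
    -- Uniform contractivity allows the inner orbit to be replaced by its limit.
    have h1 : Tendsto (fun m => S m s (S m t x - F t x)) atTop (𝓝 0) := by
      refine squeeze_zero_norm (fun m => hcontr m s _) ?_
      rw [← tendsto_iff_norm_sub_tendsto_zero]
      exact hF t x
    have h2 := h1.add (hF s (F t x))
    rw [zero_add] at h2
    refine h2.congr fun m => ?_
    rw [hadd, mul_apply_eq_comp, ← map_add, sub_add_cancel]
  · rw [continuous_iff_continuousAt]
    intro t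
    have h := (hunif x (t + 1)).continuousOn
      (Frequently.of_forall fun m => (hcont m x).continuousOn)
    exact h.continuousAt (Iic_mem_nhds (lt_add_one t))

end Semigroup

/-! ### Decay of the edge terms, uniqueness, and comparison of compressions. -/

namespace Gribov

theorem tendsto_sqrt_natCast : Tendsto (fun n : ℕ => Real.sqrt n) atTop atTop :=
  Real.tendsto_sqrt_atTop.comp tendsto_natCast_atTop_atTop

theorem tendsto_exp_neg_mul_sqrt {c : ℝ} (hc : 0 < c) :
    Tendsto (fun n : ℕ => Real.exp (-(c * Real.sqrt n))) atTop (𝓝 0) :=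
  Real.tendsto_exp_neg_atTop_nhds_zero.comp (tendsto_sqrt_natCast.const_mul_atTop hc)

theorem summable_exp_neg_mul_sqrt {c : ℝ} (hc : 0 < c) :
    Summable fun n : ℕ => Real.exp (-(c * Real.sqrt n)) := by
  -- The constant comes from `(c √n) ^ 4 / 4! ≤ exp (c √n)`.
  refine Summable.of_norm_bounded_eventually_nat
    ((Real.summable_nat_pow_inv.2 one_lt_two).mul_left (24 / c ^ 4)) ?_
  filter_upwards [eventually_ge_atTop 1] with n hn
  have hn0 : (0 : ℝ) < n := by exact_mod_cast hn
  have h := Real.pow_div_factorial_le_exp (c * Real.sqrt n) (by positivity) 4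
  have hsq : Real.sqrt n ^ 4 = (n : ℝ) ^ 2 := by
    rw [show 4 = 2 * 2 from rfl, pow_mul, Real.sq_sqrt n.cast_nonneg]
  rw [mul_pow, hsq] at h
  rw [Real.norm_of_nonneg (Real.exp_pos _).le, Real.exp_neg,
    inv_le_comm₀ (Real.exp_pos _) (by positivity)]
  refine le_trans (le_of_eq ?_) h
  simp [Nat.factorial]
  field_simp

theorem tendsto_offCoeff_mul_exp {c : ℝ} (hc : 0 < c) :
    Tendsto (fun n : ℕ => n * Real.sqrt (n + 1) * Real.exp (-(c * Real.sqrt n))) atTop (𝓝 0) := by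
  have h1 := (tendsto_exp_neg_mul_sqrt (half_pos hc)).const_mul (96 / c ^ 3)
  rw [mul_zero] at h1
  refine squeeze_zero (fun n => by positivity) (fun n => ?_) h1
  set r := Real.sqrt n with hr
  have hr0 : 0 ≤ r := Real.sqrt_nonneg _
  have hsq : r ^ 2 = n := Real.sq_sqrt n.cast_nonneg
  have h2 : (n : ℝ) * Real.sqrt (n + 1) ≤ 2 * r ^ 3 := by
    rcases n with _ | n
    · simp
      positivity
    · have h3 : Real.sqrt ((n + 1 : ℕ) + 1) ≤ 2 * r := by
        rw [Real.sqrt_le_left (by positivity), mul_pow, hsq]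
        push_cast
        nlinarith [(n.cast_nonneg : (0 : ℝ) ≤ n)]
      calc _ ≤ r ^ 2 * (2 * r) := by
            rw [hsq]
            gcongr
        _ = _ := by ring
  have h3 := Real.pow_div_factorial_le_exp (c / 2 * r) (by positivity) 3
  -- Here `48 = 3! * 2 ^ 3`: half of the exponential absorbs the cube.
  have h4 : r ^ 3 ≤ 48 / c ^ 3 * Real.exp (c / 2 * r) := by
    rw [div_mul_eq_mul_div, le_div_iff₀ (by positivity)]
    simp [Nat.factorial] at h3
    rw [div_le_iff₀ (by norm_num)] at h3
    nlinarith
  have h5 : Real.exp (-(c / 2 * r)) = Real.exp (c / 2 * r) * Real.exp (-(c * r)) := by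
    rw [← Real.exp_add]
    congr 1
    ring
  rw [h5]
  calc _ ≤ 2 * (48 / c ^ 3 * Real.exp (c / 2 * r)) * Real.exp (-(c * r)) := by
        exact mul_le_mul_of_nonneg_right (h2.trans (by linarith)) (Real.exp_pos _).le
    _ = _ := by ring

variable {E : Type*} [NormedAddCommGroup E] [InnerProductSpace ℂ E]
  (b : HilbertBasis ℕ ℂ E) {d a : ℕ → ℝ} {μ : ℝ} (lam : ℝ)

theorem exists_rate (hμ : 0 < μ) : ∃ s, 0 < s ∧ s ≤ 1 ∧ 4 * |lam| * s ≤ μ := by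
  refine ⟨min 1 (μ / (4 * (|lam| + 1))), by positivity, min_le_left _ _, ?_⟩
  calc 4 * |lam| * min 1 (μ / (4 * (|lam| + 1)))
      ≤ 4 * (|lam| + 1) * (μ / (4 * (|lam| + 1))) := by
        gcongr
        · linarith
        · exact min_le_right _ _
    _ = μ := by field_simp

/-- A square summable eigenvector of the Jacobi matrix for the eigenvalue `-1` vanishes. -/
theorem eq_zero_of_jacobi_eq_neg (hμ : 0 < μ) (hd : ∀ n : ℕ, μ * n ≤ d n)
    (ha : ∀ n, |a n| ≤ n * Real.sqrt (n + 1)) {x : E}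
    (hx : ∀ n, jacobi d a lam (fun k => inner ℂ (b k) x) n = -inner ℂ (b n) x) : x = 0 := by
  obtain ⟨s, hs0, hs1, hsμ⟩ := exists_rate lam hμ
  set u : ℕ → ℂ := fun k => inner ℂ (b k) x with hu
  have hux : ∀ n, ‖u n‖ ≤ ‖x‖ := fun n => by
    have h := norm_inner_le_norm (𝕜 := ℂ) (b n) x
    rwa [b.orthonormal.1 n, one_mul] at h
  have habs : |(-s)| = s := by rw [abs_neg, abs_of_pos hs0]
  have key : ∀ m, ∑ n ∈ Finset.range (m + 1), weight (-s) n ^ 2 * ‖u n‖ ^ 2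
      ≤ |lam| * ‖x‖ ^ 2 * (m * Real.sqrt (m + 1) * Real.exp (-(2 * s * Real.sqrt m))) := by
    intro m
    -- The coordinates of `x` are only known to be bounded, so the boundary term need not vanish by
    -- itself; the decaying weight drives it to `0` as `m` grows.
    have h := jacobi_energy (d := d) lam ha (σ := -s) (by rwa [habs]) u m
    rw [habs] at h
    have h1 : ∀ n, weight (-s) n ^ 2 * (conj (u n) * jacobi d a lam u n).re
        = -(weight (-s) n ^ 2 * ‖u n‖ ^ 2) := by
      intro n
      rw [hx n, mul_neg, Complex.conj_mul', Complex.neg_re]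
      norm_cast
      ring
    rw [Finset.sum_congr rfl fun n _ => h1 n, Finset.sum_neg_distrib] at h
    have h2 : 0 ≤ ∑ n ∈ Finset.range (m + 1),
        (d n - 4 * |lam| * s * n) * (weight (-s) n ^ 2 * ‖u n‖ ^ 2) := by
      refine Finset.sum_nonneg fun n _ => mul_nonneg ?_ (by positivity)
      have := mul_le_mul_of_nonneg_right hsμ (n.cast_nonneg : (0 : ℝ) ≤ n)
      linarith [hd n]
    have h3 : |lam| * |a m| * weight (-s) m ^ 2 * (‖u m‖ * ‖u (m + 1)‖)
        ≤ |lam| * (m * Real.sqrt (m + 1)) * weight (-s) m ^ 2 * (‖x‖ * ‖x‖) := by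
      gcongr
      · exact ha m
      · exact hux m
      · exact hux (m + 1)
    have h4 : weight (-s) m ^ 2 = Real.exp (-(2 * s * Real.sqrt m)) := by
      rw [weight, sq, ← Real.exp_add]
      congr 1
      ring
    rw [h4] at h3 h
    linarith
  have hlim := (tendsto_offCoeff_mul_exp (c := 2 * s) (by positivity)).const_mul (|lam| * ‖x‖ ^ 2)
  rw [mul_zero] at hlim
  refine b.ext_inner fun n => ?_
  rw [inner_zero_right]
  have h1 : weight (-s) n ^ 2 * ‖u n‖ ^ 2 ≤ 0 := by
    refine ge_of_tendsto hlim ?_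
    filter_upwards [eventually_ge_atTop n] with m hm
    refine le_trans ?_ (key m)
    exact Finset.single_le_sum (f := fun n => weight (-s) n ^ 2 * ‖u n‖ ^ 2)
      (fun _ _ => by positivity) (Finset.mem_range.2 (Nat.lt_succ_of_le hm))
  by_contra hne
  have h2 : 0 < ‖u n‖ := norm_pos_iff.2 hne
  have := weight_pos (-s) n
  have h3 : 0 < weight (-s) n ^ 2 * ‖u n‖ ^ 2 := by positivity
  linarith

/-- The matrix is tridiagonal: on vectors supported up to `m`, the smaller compression loses only
the entry from coordinate `m` into row `m + 1`. -/
theorem galerkin_sub_galerkin {m m' : ℕ} (hm : m < m') {x : E}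
    (hx : ∀ n, m < n → inner ℂ (b n) x = 0) :
    galerkin b d a lam m' x - galerkin b d a lam m x
      = (Complex.I * lam * (a m * inner ℂ (b m) x)) • b (m + 1) := by
  have h := orthonormal_iff_ite.1 b.orthonormal
  have htr : ∀ k, m ≤ k → (fun n => if n < k + 1 then inner ℂ (b n) x else 0)
      = fun n => inner ℂ (b n) x := by
    intro k hk
    funext n
    split_ifs with hn
    · rfl
    · rw [hx n (by omega)]
  refine b.ext_inner fun n => ?_
  rw [inner_sub_right, inner_galerkin, inner_galerkin, htr m le_rfl, htr m' hm.le,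
    inner_smul_right, h]
  rcases lt_trichotomy n (m + 1) with hn | hn | hn
  · rw [if_pos hn, if_pos (by omega), if_neg hn.ne, sub_self, mul_zero]
  · subst hn
    rw [if_neg (lt_irrefl _), if_pos (by omega), if_pos rfl, sub_zero, mul_one]
    simp [jacobi, hx (m + 1) (by omega), hx (m + 1 + 1) (by omega)]
  · rw [if_neg hn.ne', if_neg (show ¬n < m + 1 by omega), sub_zero, mul_zero]
    split_ifs
    · simp [jacobi, hx n (by omega), hx (n + 1) (by omega), hx (n - 1) (by omega)]
    · rfl

variable [CompleteSpace E]

theorem inner_galerkinEvolution_of_lt (m : ℕ) {n : ℕ} (hn : m < n) (x : E) (t : ℝ) :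
    inner ℂ (b n) (galerkinEvolution b d a lam m t x) = inner ℂ (b n) x := by
  have h : ∀ s, HasDerivAt (fun s => inner ℂ (b n) (galerkinEvolution b d a lam m s x)) 0 s := by
    intro s
    have h := ((innerSL ℂ (b n)).restrictScalars ℝ).hasFDerivAt.comp_hasDerivAt s
      (hasDerivAt_galerkinEvolution b d a lam m x s)
    refine h.congr_deriv ?_
    simp [inner_galerkin, Nat.not_lt.2 hn]
  have h2 := is_const_of_deriv_eq_zero (fun s => (h s).differentiableAt) (fun s => (h s).deriv) t 0
  simpa [galerkinEvolution_zero] using h2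

end Gribov

/-! ### The limit semigroup and its generator. -/

namespace Gribov

variable {E : Type*} [NormedAddCommGroup E] [InnerProductSpace ℂ E]

theorem _root_.HilbertBasis.tendsto_truncation (b : HilbertBasis ℕ ℂ E) (x : E) :
    Tendsto (fun m => b.truncation m x) atTop (𝓝 x) := by
  refine (b.hasSum_repr x).tendsto_sum_nat.congr fun m => ?_
  simp [HilbertBasis.truncation, b.repr_apply_apply]

variable [CompleteSpace E] (b : HilbertBasis ℕ ℂ E) {d a : ℕ → ℝ} {μ : ℝ} (lam : ℝ)

/-- In Duhamel's formula the two generators differ by the edge entry `a m * u m`; the propagated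
weight bounds it by a multiple of `m √(m + 1) exp (-s √m)`. -/
theorem galerkinEvolution_sub_le (hμ : 0 < μ) (hd : ∀ n : ℕ, μ * n ≤ d n)
    (ha : ∀ n, |a n| ≤ n * Real.sqrt (n + 1)) {x : E} {N : ℕ}
    (hx : ∀ n, N < n → inner ℂ (b n) x = 0) :
    ∃ ε : ℕ → ℝ, Tendsto ε atTop (𝓝 0) ∧ ∀ m m', N ≤ m → m < m' → ∀ t : ℝ, 0 ≤ t →
      ‖galerkinEvolution b d a lam m t x - galerkinEvolution b d a lam m' t x‖ ≤ ε m * t := by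
  obtain ⟨s, hs0, hs1, hsμ⟩ := exists_rate lam hμ
  have hd0 : ∀ n, 0 ≤ d n := fun n => le_trans (by positivity) (hd n)
  set C : ℝ := ∑ n ∈ Finset.range (N + 1), weight s n ^ 2 * ‖inner ℂ (b n) x‖ ^ 2 with hC
  have hC0 : 0 ≤ C := Finset.sum_nonneg fun n _ => by positivity
  have hlim := (tendsto_offCoeff_mul_exp hs0).const_mul (|lam| * Real.sqrt C)
  rw [mul_zero] at hlim
  refine ⟨_, hlim, fun m m' hm hmm t ht => ?_⟩
  have hcoord : ∀ r : ℝ, 0 ≤ r → ‖inner ℂ (b m) (galerkinEvolution b d a lam m r x)‖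
      ≤ Real.sqrt C * Real.exp (-(s * Real.sqrt m)) := by
    intro r hr
    -- A weight constant in time; the initial weighted sum is `C` for every `m ≥ N`, by finite
    -- support.
    have h := galerkinEvolution_weighted_le b lam hd ha m (σ := s) (κ := 0) hr le_rfl hs0.le
      (by simpa using hs1) (by simpa using hsμ) x
    rw [zero_mul, add_zero] at h
    have h1 : ∑ n ∈ Finset.range (m + 1), weight s n ^ 2 * ‖inner ℂ (b n) x‖ ^ 2 = C := by
      refine (Finset.sum_subset (Finset.range_mono (by omega)) fun n _ hn => ?_).symm
      rw [hx n (by simpa [Nat.lt_succ_iff] using hn)]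
      simp
    have h2 := (Finset.single_le_sum (f := fun n => weight s n ^ 2 *
      ‖inner ℂ (b n) (galerkinEvolution b d a lam m r x)‖ ^ 2) (fun _ _ => by positivity)
      (Finset.self_mem_range_succ m)).trans (h.trans_eq h1)
    rw [← mul_pow] at h2
    have h3 := Real.le_sqrt_of_sq_le h2
    have h4 : weight s m * Real.exp (-(s * Real.sqrt m)) = 1 := by
      rw [weight, ← Real.exp_add, add_neg_cancel, Real.exp_zero]
    calc _ = weight s m * ‖inner ℂ (b m) (galerkinEvolution b d a lam m r x)‖
          * Real.exp (-(s * Real.sqrt m)) := by rw [mul_right_comm, h4, one_mul]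
      _ ≤ _ := mul_le_mul_of_nonneg_right h3 (Real.exp_pos _).le
  refine norm_exp_smul_sub_le ht
    (fun r hr y => norm_galerkinEvolution_le b lam hd0 ha m' hr y) fun r hr => ?_
  change ‖(-galerkin b d a lam m - -galerkin b d a lam m') (galerkinEvolution b d a lam m r x)‖ ≤ _
  rw [neg_sub_neg, _root_.sub_apply, galerkin_sub_galerkin b lam hmm, norm_smul,
    b.orthonormal.1, mul_one, norm_mul, norm_mul, norm_mul, Complex.norm_I, one_mul,
    Complex.norm_real, Complex.norm_real, Real.norm_eq_abs, Real.norm_eq_abs]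
  · calc _ ≤ |lam| * ((m * Real.sqrt (m + 1)) * (Real.sqrt C * Real.exp (-(s * Real.sqrt m)))) := by
          gcongr
          · exact ha m
          · exact hcoord r hr
      _ = _ := by ring
  · intro n hn
    rw [inner_galerkinEvolution_of_lt b lam m hn, hx n (by omega)]

theorem uniformCauchySeqOn_galerkinEvolution (hμ : 0 < μ) (hd : ∀ n : ℕ, μ * n ≤ d n)
    (ha : ∀ n, |a n| ≤ n * Real.sqrt (n + 1)) (x : E) (R : ℝ≥0) :
    UniformCauchySeqOn (fun m (t : ℝ≥0) => galerkinEvolution b d a lam m t x) atTop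
      (Set.Iic R) := by
  have hd0 : ∀ n, 0 ≤ d n := fun n => le_trans (by positivity) (hd n)
  rw [Metric.uniformCauchySeqOn_iff]
  intro δ hδ
  obtain ⟨N, hN⟩ := (Metric.tendsto_atTop.1 (b.tendsto_truncation x)) (δ / 4) (by positivity)
  set y := b.truncation N x with hy
  have hxy : ‖x - y‖ < δ / 4 := by
    rw [← dist_eq_norm, dist_comm]
    exact hN N le_rfl
  obtain ⟨ε, hε, hest⟩ := galerkinEvolution_sub_le b lam hμ hd ha (x := y) (N := N) fun n hn => by
    rw [hy, b.inner_truncation, if_neg (by omega)]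
  have hεR := hε.mul_const (R : ℝ)
  rw [zero_mul] at hεR
  obtain ⟨M, hM⟩ := eventually_atTop.1
    (((tendsto_order.1 hεR).2 (δ / 2) (by positivity)).and
      ((eventually_ge_atTop N).and (eventually_ge_atTop 0)))
  have hlt : ∀ m m', M ≤ m → m < m' → ∀ t ∈ Set.Iic R,
      dist (galerkinEvolution b d a lam m t x) (galerkinEvolution b d a lam m' t x) < δ := by
    intro m m' hm hmm t ht
    have ht' : (t : ℝ) ≤ R := ht
    have h1 := hest m m' (hM m hm).2.1 hmm t t.coe_nonneg
    have h2 := norm_galerkinEvolution_le b lam hd0 ha m t.coe_nonneg (x - y)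
    have h3 := norm_galerkinEvolution_le b lam hd0 ha m' t.coe_nonneg (x - y)
    have h4 := (hM m hm).1
    rw [map_sub] at h2 h3
    set p := galerkinEvolution b d a lam m t x
    set p' := galerkinEvolution b d a lam m' t x
    set q := galerkinEvolution b d a lam m t y
    set q' := galerkinEvolution b d a lam m' t y
    -- Contractivity makes the outer differences smaller than `δ / 4` each; the middle one concerns
    -- finitely supported data.
    have h5 : p - p' = (p - q) + (q - q') - (p' - q') := by abel
    have h6 : ε m * t < δ / 2 := by
      rcases le_total 0 (ε m) with h | h
      · exact (mul_le_mul_of_nonneg_left ht' h).trans_lt h4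
      · exact (mul_nonpos_of_nonpos_of_nonneg h t.coe_nonneg).trans_lt (by positivity)
    rw [dist_eq_norm, h5]
    have h7 := norm_sub_le ((p - q) + (q - q')) (p' - q')
    have h8 := norm_add_le (p - q) (q - q')
    linarith
  refine ⟨M, fun m hm m' hm' t ht => ?_⟩
  rcases lt_trichotomy m m' with h | h | h
  · exact hlt m m' hm h t ht
  · rw [h, dist_self]
    exact hδ
  · rw [dist_comm]
    exact hlt m' m hm' h t ht

/-- The semigroup generated by a Jacobi matrix, with its properties. -/
theorem exists_jacobi_semigroup (hμ : 0 < μ) (hd : ∀ n : ℕ, μ * n ≤ d n)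
    (ha : ∀ n, |a n| ≤ n * Real.sqrt (n + 1)) :
    ∃ T : C0Semigroup E, (∀ t x, ‖T.toFun t x‖ ≤ ‖x‖) ∧
      ∀ x R, TendstoUniformlyOn (fun m (t : ℝ≥0) => galerkinEvolution b d a lam m t x)
        (fun t => T.toFun t x) atTop (Set.Iic R) :=
  exists_limit_semigroup (fun m t => galerkinEvolution b d a lam m t)
    (fun m => galerkinEvolution_zero b d a lam m)
    (fun m s t => galerkinEvolution_add b d a lam m s t)
    (fun m x => (continuous_iff_continuousAt.2 fun t =>
      (hasDerivAt_galerkinEvolution b d a lam m x t).continuousAt).comp NNReal.continuous_coe)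
    (fun m t x => norm_galerkinEvolution_le b lam
      (fun n => le_trans (by positivity) (hd n)) ha m t.coe_nonneg x)
    (fun x R => uniformCauchySeqOn_galerkinEvolution b lam hμ hd ha x R)

variable {b lam} {T : C0Semigroup E}

/-- The generator acts on coordinates through the Jacobi matrix. -/
theorem tendsto_inner_orbit
    (hlim : ∀ x R, TendstoUniformlyOn (fun m (t : ℝ≥0) => galerkinEvolution b d a lam m t x)
      (fun t => T.toFun t x) atTop (Set.Iic R)) (x : E) (n : ℕ) :
    Tendsto (fun t : ℝ≥0 => ((t : ℝ)⁻¹ : ℂ) * inner ℂ (b n) (T.toFun t x - x)) (𝓝[>] 0)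
      (𝓝 (-jacobiRow b d a lam n x)) := by
  set ρ := jacobiRow b d a lam n with hρ
  rw [Metric.tendsto_nhdsWithin_nhds]
  intro ε hε
  have hρ0 : 0 < ‖ρ‖ + 1 := by positivity
  set η : ℝ := ε / (4 * (‖ρ‖ + 1)) with hη
  have hη0 : 0 < η := by positivity
  have hcont := (Metric.continuous_iff.1 (T.continuous_orbit x)) 0 η hη0
  obtain ⟨δ, hδ, hclose⟩ := hcont
  rw [T.map_zero] at hclose
  refine ⟨δ, hδ, fun {t} ht htδ => ?_⟩
  have ht0 : (0 : ℝ) < t := NNReal.coe_pos.2 ht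
  have hunif := Metric.tendstoUniformlyOn_iff.1 (hlim x t) η hη0
  have hstep : ∀ᶠ m in atTop, ‖inner ℂ (b n) (galerkinEvolution b d a lam m t x) - inner ℂ (b n) x
      + t * ρ x‖ ≤ ε / 2 * t := by
    -- For `m ≥ n + 1` both neighbours of `n` lie in the compression, so its row `n` is exact. The
    -- function differentiated below then has derivative `-ρ` of a displacement of norm at most `2
    -- η`, whence the choice of `η`.
    filter_upwards [hunif, eventually_ge_atTop (n + 1)] with m hm hmn
    have hder : ∀ s : ℝ, HasDerivAt
        (fun s : ℝ => inner ℂ (b n) (galerkinEvolution b d a lam m s x) + s * ρ x)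
        (-ρ (galerkinEvolution b d a lam m s x - x)) s := by
      intro s
      have h1 := ((innerSL ℂ (b n)).restrictScalars ℝ).hasFDerivAt.comp_hasDerivAt s
        (hasDerivAt_galerkinEvolution b d a lam m x s)
      have h2 := Complex.ofRealCLM.hasDerivAt (x := s) |>.mul_const (ρ x)
      refine (h1.add h2).congr_deriv ?_
      have h3 : ρ (galerkinEvolution b d a lam m s x)
          = inner ℂ (b n) (galerkin b d a lam m (galerkinEvolution b d a lam m s x)) := by
        rw [inner_galerkin, if_pos (by omega), hρ, jacobiRow_apply]
        simp only [jacobi]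
        rw [if_pos (by omega), if_pos (by omega), if_pos (by omega)]
      rw [map_sub, h3]
      simp
      ring
    have hb := norm_image_sub_le_of_norm_deriv_le_segment' (a := 0) (b := (t : ℝ)) (C := ε / 2)
      (fun s _ => (hder s).hasDerivWithinAt) (fun s hs => ?_) t (Set.right_mem_Icc.2 ht0.le)
    · simp only [galerkinEvolution_zero, sub_zero, Complex.ofReal_zero, zero_mul, add_zero] at hb
      refine le_trans (le_of_eq ?_) hb
      congr 1
      simp
      ring
    · lift s to ℝ≥0 using hs.1
      have hs2 : s < t := by exact_mod_cast hs.2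
      have e1 := hm s (Set.mem_Iic.2 hs2.le)
      have e2 := hclose s (lt_of_le_of_lt (by
        rw [NNReal.dist_eq, NNReal.dist_eq]
        simp only [NNReal.coe_zero, sub_zero, abs_of_nonneg s.coe_nonneg,
          abs_of_nonneg t.coe_nonneg]
        exact hs.2.le) htδ)
      change dist (T.toFun s x) x < η at e2
      have e3 : ‖galerkinEvolution b d a lam m s x - x‖ ≤ 2 * η := by
        rw [← dist_eq_norm]
        have := dist_triangle (galerkinEvolution b d a lam m s x) (T.toFun s x) x
        have e4 := dist_comm (galerkinEvolution b d a lam m s x) (T.toFun s x)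
        linarith
      rw [norm_neg]
      calc _ ≤ ‖ρ‖ * (2 * η) := (ρ.le_opNorm _).trans (by gcongr)
        _ ≤ (‖ρ‖ + 1) * (2 * η) := by gcongr; linarith
        _ = ε / 2 := by rw [hη]; field_simp; ring
  have hpt : Tendsto (fun m => galerkinEvolution b d a lam m t x) atTop (𝓝 (T.toFun t x)) :=
    (hlim x t).tendsto_at (Set.mem_Iic.2 le_rfl)
  have hfin : ‖inner ℂ (b n) (T.toFun t x) - inner ℂ (b n) x + t * ρ x‖ ≤ ε / 2 * t :=
    le_of_tendsto (((((innerSL ℂ (b n)).continuous.tendsto _).comp hpt).sub_const _).add_const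
      _).norm hstep
  have htc : ((t : ℝ) : ℂ) ≠ 0 := by exact_mod_cast ht0.ne'
  have heq : ((t : ℝ)⁻¹ : ℂ) * inner ℂ (b n) (T.toFun t x - x) - -ρ x
      = ((t : ℝ)⁻¹ : ℂ) * (inner ℂ (b n) (T.toFun t x) - inner ℂ (b n) x + t * ρ x) := by
    rw [inner_sub_right, mul_add, inv_mul_cancel_left₀ htc, sub_neg_eq_add]
  rw [dist_eq_norm, heq, norm_mul, norm_inv, Complex.norm_real, Real.norm_of_nonneg ht0.le]
  calc _ ≤ (t : ℝ)⁻¹ * (ε / 2 * t) := by gcongr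
    _ = ε / 2 := by field_simp
    _ < ε := by linarith

/-- Starting from the trivial weight, the growing weight gives every image vector the decay `exp (-κ
t √n)`. -/
theorem carlemanClass_jacobi_semigroup (hμ : 0 < μ) (hd : ∀ n : ℕ, μ * n ≤ d n)
    (ha : ∀ n, |a n| ≤ n * Real.sqrt (n + 1))
    (hlim : ∀ x R, TendstoUniformlyOn (fun m (t : ℝ≥0) => galerkinEvolution b d a lam m t x)
      (fun t => T.toFun t x) atTop (Set.Iic R)) {t : ℝ≥0} (ht : 0 < t) {p : ℝ} (hp : 0 < p) :
    CarlemanClass p (T.toFun t) := by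
  obtain ⟨s, hs0, hs1, hsμ⟩ := exists_rate lam (half_pos hμ)
  have ht0 : (0 : ℝ) < t := NNReal.coe_pos.2 ht
  -- Half of `μ` pays for the growth rate `κ`, the other half for the coupling, since `κ t ≤ s` and
  -- `4 |lam| s ≤ μ / 2`.
  set κ : ℝ := min (s / t) (μ / 2) with hκ
  have hκ0 : 0 < κ := by positivity
  have hκt : κ * t ≤ s := by
    rw [← le_div_iff₀ ht0]
    exact min_le_left _ _
  have hκt0 : 0 < κ * t := by positivity
  have hinv : ∀ n, (weight (κ * t) n)⁻¹ = Real.exp (-(κ * t * Real.sqrt n)) := fun n => by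
    rw [weight, Real.exp_neg]
  refine carlemanClass_of_decay b (q := weight (κ * t)) (fun i j hij => ?_)
    (weight_pos _) (fun x M => ?_) ?_ hp ?_
  · refine Real.exp_le_exp.2 (mul_le_mul_of_nonneg_left (Real.sqrt_le_sqrt ?_) hκt0.le)
    exact_mod_cast hij
  · have hpt : Tendsto (fun m => galerkinEvolution b d a lam m t x) atTop (𝓝 (T.toFun t x)) :=
      (hlim x t).tendsto_at (Set.mem_Iic.2 le_rfl)
    refine le_of_tendsto (tendsto_finsetSum _ fun n _ =>
      (((((innerSL ℂ (b n)).continuous.tendsto _).comp hpt).norm.pow 2).const_mul _)) ?_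
    filter_upwards [eventually_ge_atTop M] with m hm
    have h := galerkinEvolution_weighted_le b lam hd ha m (σ := 0) (κ := κ) ht0.le hκ0.le le_rfl
      (by linarith) (by
        have h1 : 4 * |lam| * (0 + κ * t) ≤ 4 * |lam| * s := by
          rw [zero_add]
          gcongr
        have h2 : κ ≤ μ / 2 := min_le_right _ _
        linarith) x
    simp only [zero_add, weight_zero, one_pow, one_mul] at h
    refine le_trans ?_ (h.trans (b.orthonormal.sum_inner_products_le x))
    exact Finset.sum_le_sum_of_subset_of_nonneg (Finset.range_mono (by omega))
      fun _ _ _ => by positivity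
  · simp only [hinv]
    exact tendsto_exp_neg_mul_sqrt hκt0
  · refine (summable_exp_neg_mul_sqrt (c := κ * t * p) (by positivity)).congr fun n => ?_
    rw [hinv, ← Real.exp_mul]
    congr 1
    ring

/-- Operators given by a Jacobi matrix with imaginary off-diagonal part of order `n ^ (3 / 2)` and
diagonal part at least linear: minus the maximal operator generates a semigroup in all the Carleman
classes. -/
theorem exists_semigroup_of_jacobi (b : HilbertBasis ℕ ℂ E) (lam : ℝ) (hμ : 0 < μ)
    (hd : ∀ n : ℕ, μ * n ≤ d n) (ha : ∀ n, |a n| ≤ n * Real.sqrt (n + 1)) (L : E →ₗ.[ℂ] E)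
    (hL : ∀ x y, (x, y) ∈ L.graph ↔
      ∀ n, inner ℂ (b n) y = jacobi d a lam (fun k => inner ℂ (b k) x) n) :
    ∃ T : C0Semigroup E, T.IsGenerator (-L) ∧
      ∀ t : ℝ≥0, 0 < t → ∀ p : ℝ, 0 < p → CarlemanClass p (T.toFun t) := by
  obtain ⟨T, hT, hlim⟩ := exists_jacobi_semigroup b lam hμ hd ha
  refine ⟨T, ?_, fun t ht p hp => carlemanClass_jacobi_semigroup hμ hd ha hlim ht hp⟩
  have hneg : ∀ x y, (x, y) ∈ (-L).graph ↔
      ∀ n, inner ℂ (b n) y = -jacobiRow b d a lam n x := by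
    intro x y
    have h1 : (x, y) ∈ (-L).graph ↔ (x, -y) ∈ L.graph := by
      rw [LinearPMap.neg_graph, Submodule.mem_map]
      constructor
      · rintro ⟨⟨x', y'⟩, h, he⟩
        obtain ⟨rfl, rfl⟩ := Prod.mk.injEq .. ▸ he
        simpa using h
      · intro h
        exact ⟨(x, -y), h, by simp⟩
    rw [h1, hL]
    refine forall_congr' fun n => ?_
    rw [jacobiRow_apply, inner_neg_right, neg_eq_iff_eq_neg]
  have hgen : ∀ x y : E, Tendsto (fun t : ℝ≥0 => ((t : ℝ)⁻¹ : ℂ) • (T.toFun t x - x)) (𝓝[>] 0)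
      (𝓝 y) → (x, y) ∈ (-L).graph := by
    intro x y h
    rw [hneg]
    intro n
    refine tendsto_nhds_unique (((innerSL ℂ (b n)).continuous.tendsto y).comp h)
      ((tendsto_inner_orbit hlim x n).congr fun t => ?_)
    rw [Function.comp_apply, innerSL_apply_apply, inner_smul_right]
  refine fun x y => ⟨fun h => ?_, hgen x y⟩
  -- This `z` lies in the domain of the generator, hence of `-L`, and `z - x` is an eigenvector of
  -- `L` for `-1`, or zero; uniqueness gives `z = x`.
  obtain ⟨z, hz⟩ := T.exists_resolvent hT (x - y)
  have hz' := hgen _ _ hz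
  have hzx : z = x := by
    rw [← sub_eq_zero]
    refine eq_zero_of_jacobi_eq_neg b lam hμ hd ha fun n => ?_
    rw [hneg] at h hz'
    have h1 := h n
    have h2 := hz' n
    rw [← jacobiRow_apply, map_sub]
    simp only [inner_sub_right] at h2 ⊢
    linear_combination h2 - h1
  rwa [hzx, sub_sub_cancel] at hz

end Gribov

theorem theorem8p8 (lam'' μ lam : ℝ) (hlam'' : 0 ≤ lam'') (hμ : 0 < μ) :
    ∃ T : C0Semigroup Gribov.Bargmann,
      T.IsGenerator (-Gribov.gribovOperator lam'' μ lam) ∧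
        ∀ t : ℝ≥0, 0 < t → ∀ p : ℝ, 0 < p → CarlemanClass p (T.toFun t) := by
  refine Gribov.exists_semigroup_of_jacobi Gribov.Bargmann.basis lam hμ (fun n => ?_) (fun n => ?_)
    _ (Gribov.mem_graph_gribovOperator lam'' μ lam)
  · have h : (0 : ℝ) ≤ n * (n - 1) * (n - 2) := by
      rcases n with _ | _ | n
      · simp
      · simp
      · push_cast
        have : (0 : ℝ) ≤ n := n.cast_nonneg
        have h1 : (n : ℝ) + 1 + 1 - 1 = n + 1 := by ring
        have h2 : (n : ℝ) + 1 + 1 - 2 = n := by ring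
        rw [h1, h2]
        positivity
    -- Only the sign of the cubic diagonal term matters: it preserves `d n ≥ μ n`.
    have := mul_nonneg hlam'' h
    rw [Gribov.diagCoeff]
    linarith
  · rw [Gribov.offCoeff, abs_of_nonneg (by positivity)]
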